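/- For a measurable symmetric $W:[0,1]^2\to[0,1]$ and a finite simple graph $H$ let $t_H(W)=\int_{[0,1]^{V(H)}}\prod_{ij\in E(H)}W(x_i,x_j)\,dx$, and for a graph $G$ let $t_H(G)=|V(G)|^{-|V(H)|}\,|\hom(H,G)|$. Let $I_p(x)=\frac x2\log\frac xp+\frac{1-x}2\log\frac{1-x}{1-p}$ and $I_p(W)=\int_{[0,1]^2}I_p(W(x,y))\,dx\,dy$. Let $\widehat{\mathscr G}_n$ be the set of weighted graphs on $\{1,\dots,n\}$, i.e. symmetric arrays $\widehat G=(a_{ij})$ with $0\le a_{ij}\le 1$ and $a_{ii}=0$, and put $W_{\widehat G}(x,y)=a_{\lceil nx\rceil,\lceil ny\rceil}$. Fix $b>1$ and a finite simple graph $H$ with $\kappa\ge 1$ edges. For integers $0\le m\le\binom n2$ put $p=m/\binom n2$ and, for real $t$, \[\widehat\psi_H(n,m,t)=\inf\Big\{I_{p}(W_{\widehat G}) : \widehat G\in\widehat{\mathscr G}_n,\ t_H(W_{\widehat G})\ge t\,p^\kappa,\ \sum_{i<j}a_{ij}=m\Big\}\in(-\infty,\infty],\] with $\inf\emptyset=+\infty$.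 Let $G_n$ be uniformly distributed over the graphs on $\{1,\dots,n\}$ with exactly $m_n$ edges, $p_n=m_n/\binom n2$, and let $\log 0=-\infty$. (1) For every $\epsilon>0$ there exists $K<\infty$ such that, for all sufficiently large $n$ and every $m_n\le\binom n2$ with $p_n(\log n)^{1/(2\kappa)}\ge K$, \[-\widehat\psi_H(n,m_n,b+\epsilon)-\epsilon\ \le\ \frac1{n^2}\log\mathbb P\big(t_H(G_n)\ge b\,p_n^\kappa\big)\ \le\ -\widehat\psi_H(n,m_n,b-\epsilon)+\epsilon .\] (2) In particular, if $m_n\le\binom n2$ is a sequence with $p_n(\log n)^{1/(2\kappa)}\to\infty$, and the limit $\lim_{n\to\infty}\widehat\psi_H(n,m_n,t)$ exists (in the extended reals) for every $t$ in a neighborhood of $b$ and is continuous in $t$ there, then \[\lim_{n\to\infty}\frac1{n^2}\log\mathbb P\big(t_H(G_n)\ge b\,p_n^\kappa\big)=-\lim_{n\to\infty}\widehat\psi_H(n,m_n,b).\] -/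

import Mathlib

open MeasureTheory ProbabilityTheory Filter Topology

noncomputable section

/-- A graphon: a symmetric measurable function from the unit square to `[0,1]`. -/
structure Graphon where
  toFun : unitInterval → unitInterval → ℝ
  symm' : ∀ x y, toFun x y = toFun y x
  measurable' : Measurable fun z : unitInterval × unitInterval => toFun z.1 z.2
  nonneg' : ∀ x y, 0 ≤ toFun x y
  le_one' : ∀ x y, toFun x y ≤ 1

/-- The value of a graphon at the unordered pair of points assigned to the ends of `e`. -/
def Graphon.edgeValue {V : Type*} (W : Graphon) (x : V → unitInterval) (e : Sym2 V) : ℝ :=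
  Sym2.lift ⟨fun i j => W.toFun (x i) (x j), fun i j => W.symm' (x i) (x j)⟩ e

/-- The density `t_H(W)` of the graph `H` in the graphon `W`: the integral over `[0,1]^V` of the
product over the edges `ij` of `H` of `W (x i) (x j)`. -/
def Graphon.homDensity {V : Type*} [Fintype V] (H : SimpleGraph V) [Fintype H.edgeSet]
    (W : Graphon) : ℝ :=
  ∫ x : V → unitInterval, ∏ e ∈ H.edgeFinset, W.edgeValue x e

/-- `I_p(x) = (x/2) log (x/p) + ((1-x)/2) log ((1-x)/(1-p))` (meant for `0 < p < 1`,
`0 ≤ x ≤ 1`, with `0 log 0 = 0`). -/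
def relEntropy (p x : ℝ) : ℝ :=
  x / 2 * Real.log (x / p) + (1 - x) / 2 * Real.log ((1 - x) / (1 - p))

/-- `I_p(W)`, the integral of `I_p(W(x,y))` over the unit square. -/
def Graphon.relEntropy (p : ℝ) (W : Graphon) : ℝ :=
  ∫ z : unitInterval × unitInterval, _root_.relEntropy p (W.toFun z.1 z.2)

/-- Weighted undirected loopless graphs on `n` vertices, with weights in `[0,1]`. -/
structure EdgeWeightedGraph (n : ℕ) where
  weight : Fin n → Fin n → ℝ
  symm' : ∀ i j, weight i j = weight j i
  diag' : ∀ i, weight i i = 0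
  nonneg' : ∀ i j, 0 ≤ weight i j
  le_one' : ∀ i j, weight i j ≤ 1

/-- The cell of the partition of `(0,1]` into `n` intervals of equal length that has index `i`,
indices starting at `0`: the points `x` with `⌈n x⌉ = i + 1`. -/
def cell (n : ℕ) (i : Fin n) : Set unitInterval :=
  {x | ⌈(n : ℝ) * (x : ℝ)⌉₊ = (i : ℕ) + 1}

open Classical in
/-- The function `(x,y) ↦ a_{⌈nx⌉,⌈ny⌉}` (with the value `0` where an index is `0`, i.e. where
`x = 0` or `y = 0`). -/
def EdgeWeightedGraph.stepFun {n : ℕ} (A : EdgeWeightedGraph n) (x y : unitInterval) : ℝ :=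
  ∑ i, ∑ j, if x ∈ cell n i ∧ y ∈ cell n j then A.weight i j else 0

theorem EdgeWeightedGraph.stepFun_mem {n : ℕ} (A : EdgeWeightedGraph n) (x y : unitInterval) :
    A.stepFun x y = 0 ∨ ∃ i j, A.stepFun x y = A.weight i j := by
  classical
  have huniq : ∀ (z : unitInterval) (i i' : Fin n), z ∈ cell n i → z ∈ cell n i' → i = i' := by
    intro z i i' h h'
    simp only [cell, Set.mem_ofPred_eq] at h h'
    exact Fin.ext (by omega)
  by_cases hx : ∃ i, x ∈ cell n i
  · by_cases hy : ∃ j, y ∈ cell n j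
    · obtain ⟨i, hi⟩ := hx
      obtain ⟨j, hj⟩ := hy
      refine Or.inr ⟨i, j, ?_⟩
      unfold EdgeWeightedGraph.stepFun
      rw [Finset.sum_eq_single i, Finset.sum_eq_single j]
      · simp [hi, hj]
      · intro j' _ hne
        exact if_neg fun h => hne (huniq y _ _ h.2 hj)
      · simp
      · intro i' _ hne
        exact Finset.sum_eq_zero fun j' _ => if_neg fun h => hne (huniq x _ _ h.1 hi)
      · simp
    · left
      exact Finset.sum_eq_zero fun i _ => Finset.sum_eq_zero fun j _ =>
        if_neg fun h => hy ⟨j, h.2⟩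
  · left
    exact Finset.sum_eq_zero fun i _ => Finset.sum_eq_zero fun j _ =>
      if_neg fun h => hx ⟨i, h.1⟩

theorem measurableSet_cell (n : ℕ) (i : Fin n) : MeasurableSet (cell n i) := by
  have h : Measurable fun x : unitInterval => ⌈(n : ℝ) * (x : ℝ)⌉₊ :=
    Nat.measurable_ceil.comp (measurable_subtype_coe.const_mul _)
  exact h (measurableSet_singleton ((i : ℕ) + 1))

/-- The graphon `W_A` of a weighted graph `A`. -/
def EdgeWeightedGraph.graphon {n : ℕ} (A : EdgeWeightedGraph n) : Graphon where
  toFun := A.stepFun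
  symm' x y := by
    classical
    unfold EdgeWeightedGraph.stepFun
    rw [Finset.sum_comm]
    refine Finset.sum_congr rfl fun i _ => Finset.sum_congr rfl fun j _ => ?_
    simp only [and_comm, A.symm' i j]
  measurable' := by
    classical
    unfold EdgeWeightedGraph.stepFun
    refine Finset.measurable_sum _ fun i _ => Finset.measurable_sum _ fun j _ => ?_
    refine Measurable.ite ?_ measurable_const measurable_const
    exact (measurableSet_cell n i).prod (measurableSet_cell n j)
  nonneg' x y := by
    rcases A.stepFun_mem x y with h | ⟨i, j, h⟩ <;> rw [h]
    exact A.nonneg' i j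
  le_one' x y := by
    rcases A.stepFun_mem x y with h | ⟨i, j, h⟩ <;> rw [h]
    · exact zero_le_one
    · exact A.le_one' i j

/-- `p = m / (n choose 2)`. -/
def edgeDensity (n m : ℕ) : ℝ := (m : ℝ) / (n.choose 2 : ℝ)

/-- The feasible set of the variational problem: the weighted graphs on `n` vertices of total
edge weight `m` and with `t_H ≥ b p^κ`. -/
def feasibleGraphs {V : Type*} [Fintype V] (H : SimpleGraph V) [Fintype H.edgeSet]
    (n m : ℕ) (b : ℝ) : Set (EdgeWeightedGraph n) :=
  {A | b * edgeDensity n m ^ H.edgeFinset.card ≤ A.graphon.homDensity H ∧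
    ∑ i, ∑ j ∈ Finset.Ioi i, A.weight i j = (m : ℝ)}

/-- The discrete variational problem `ψ̂_H(n,m,b)`; the infimum over the empty set is `+∞`. -/
def psiHat {V : Type*} [Fintype V] (H : SimpleGraph V) [Fintype H.edgeSet]
    (n m : ℕ) (b : ℝ) : EReal :=
  ⨅ A ∈ feasibleGraphs H n m b, ((A.graphon.relEntropy (edgeDensity n m) : ℝ) : EReal)

/-- The law of `G(n,m)`: the uniform distribution on the graphs on `n` labelled vertices with
exactly `m` edges. -/
def uniformGraph (n m : ℕ) : Measure (SimpleGraph (Fin n)) :=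
  uniformOn {G : SimpleGraph (Fin n) | G.edgeSet.ncard = m}

/-- `t_H(G) = |V(G)|^{-|V(H)|} |hom(H,G)|`. -/
def graphHomDensity {V : Type*} [Fintype V] (H : SimpleGraph V) {n : ℕ}
    (G : SimpleGraph (Fin n)) : ℝ :=
  (Nat.card (H →g G) : ℝ) / (n : ℝ) ^ Fintype.card V

/-- `n⁻² log P(t_H(G_n) ≥ b p^κ)` for `G_n ∼ G(n,m)`, an extended real (`log 0 = -∞`). -/
def logUpperTail {V : Type*} [Fintype V] (H : SimpleGraph V) [Fintype H.edgeSet]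
    (n m : ℕ) (b : ℝ) : EReal :=
  (((1 / (n : ℝ) ^ 2 : ℝ)) : EReal) * ENNReal.log (uniformGraph n m
    {G | b * edgeDensity n m ^ H.edgeFinset.card ≤ graphHomDensity H G})

end

/-!
The upper tail of the number of copies of `H` in `G(n,m)` is compared with the entropic variational
problem directly on `n` vertices, by counting graphs. Write `p` for the edge density, `N` for the
number of pairs of vertices and `h` for the binary entropy. For weights `w` of mean `p` on the
pairs, twice the sum of the relative entropies is `N h(p) - ∑ h(w)`, and there are
`exp (N h(p) + o(n²))` graphs with `m` edges. So it suffices to see that the graphs with many copies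
of `H` number `exp (sup ∑ h(w) + o(n²))`, the supremum being over the feasible weights.

*Upper bound.* By weak regularity (`exists_coloring_cut_le`) each graph is within `ε p^κ / κ` in the
cut norm of its averages over the blocks of a partition, and by the counting lemma
(`abs_pairDensity_sub_le`) the averages have almost as many copies of `H` as the graph. Averages are
taken over pairs of distinct vertices, so they keep the total weight `m` exactly and are feasible
(`exists_coloring_feasible`). At most `exp (∑ h(q))` graphs have the averages `q`, because
independent edges with probabilities `q` give each of them the probability `exp (-∑ h(q))`
(`subsetWeight_blockAverage`). The number of parts is exponential in `p^{-2κ}`, hence a small power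
of `n` when `p^{2κ} log n` is large, and then partitions and edge counts together contribute only a
factor `exp (o(n²))` (`card_le_of_exists_coloring`).

*Lower bound.* Sample the edges independently with probabilities a feasible `w`. The expected
density of `H` is at least that of `w` (`pairDensity_le_sum_subsetWeight`), so by Markov's
inequality it is nearly attained with probability at least `1 / n`; no concentration of the density
is needed. By Chebyshev's inequality the number of edges is within `n^{3/2}` of `m` and the
likelihood within a factor `exp (n^{3/2})` of `exp (-∑ h(w))`, except with smaller probability
(`le_card_filter_of_subsetWeight`). Changing `O(n^{3/2})` edges makes the number of edges exactly
`m`, at a cost of a factor `exp (O(n^{3/2} log n))` (`card_le_mul_card_near`).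
-/

/-! ### Random subsets with independent memberships -/

section BernoulliSubsets

variable {α : Type*} [DecidableEq α]

/-- The probability of the set `S` when each `f ∈ E` is kept independently with probability
`a f`. -/
noncomputable def subsetWeight (E : Finset α) (a : α → ℝ) (S : Finset α) : ℝ :=
  (∏ f ∈ S, a f) * ∏ f ∈ E \ S, (1 - a f)

lemma subsetWeight_nonneg {E S : Finset α} {a : α → ℝ} (hS : S ⊆ E)
    (h0 : ∀ f ∈ E, 0 ≤ a f) (h1 : ∀ f ∈ E, a f ≤ 1) : 0 ≤ subsetWeight E a S :=
  mul_nonneg (Finset.prod_nonneg fun f hf => h0 f (hS hf))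
    (Finset.prod_nonneg fun f hf => sub_nonneg.2 (h1 f (Finset.sdiff_subset hf)))

lemma sum_subsetWeight (E : Finset α) (a : α → ℝ) :
    ∑ S ∈ E.powerset, subsetWeight E a S = 1 := by
  unfold subsetWeight
  rw [← Finset.prod_add]
  simp

lemma sum_subsetWeight_superset {E F : Finset α} (a : α → ℝ) (hF : F ⊆ E) :
    ∑ S ∈ E.powerset, subsetWeight E a S * (if F ⊆ S then 1 else 0) = ∏ f ∈ F, a f := by
  have key : ∀ S ∈ E.powerset, subsetWeight E a S * (if F ⊆ S then 1 else 0) =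
      (∏ f ∈ S, a f) * ∏ f ∈ E \ S, (if f ∈ F then 0 else 1 - a f) := by
    intro S _
    by_cases h : F ⊆ S
    · rw [if_pos h, mul_one, subsetWeight]
      congr 1
      refine Finset.prod_congr rfl fun f hf => ?_
      rw [if_neg fun hfF => (Finset.mem_sdiff.1 hf).2 (h hfF)]
    · obtain ⟨f, hfF, hfS⟩ := Finset.not_subset.1 h
      have h0 : ∏ f ∈ E \ S, (if f ∈ F then 0 else 1 - a f) = 0 :=
        Finset.prod_eq_zero (Finset.mem_sdiff.2 ⟨hF hfF, hfS⟩) (if_pos hfF)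
      rw [if_neg h, mul_zero, h0, mul_zero]
  rw [Finset.sum_congr rfl key, ← Finset.prod_add, ← Finset.prod_sdiff hF]
  have h1 : ∏ f ∈ E \ F, (a f + if f ∈ F then 0 else 1 - a f) = 1 :=
    Finset.prod_eq_one fun f hf => by rw [if_neg (Finset.mem_sdiff.1 hf).2]; ring
  rw [h1, one_mul]
  exact Finset.prod_congr rfl fun f hf => by rw [if_pos hf, add_zero]

/-- The sum over `f ∈ E` of `c f` where `f ∈ S` and of `d f` where `f ∉ S`. -/
def splitSum (E : Finset α) (c d : α → ℝ) (S : Finset α) : ℝ :=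
  ∑ f ∈ S, c f + ∑ f ∈ E \ S, d f

/-- A sum of independent centred variables has as variance the sum of the variances. -/
lemma sum_subsetWeight_mul_splitSum_sq (E : Finset α) (a c d : α → ℝ)
    (h : ∀ f ∈ E, a f * c f + (1 - a f) * d f = 0) :
    ∑ S ∈ E.powerset, subsetWeight E a S * splitSum E c d S ^ 2 =
      ∑ f ∈ E, (a f * c f ^ 2 + (1 - a f) * d f ^ 2) := by
  induction E using Finset.induction_on with
  | empty => simp [subsetWeight, splitSum]
  | insert e E he ih =>
    rw [Finset.sum_powerset_insert he, ← Finset.sum_add_distrib, Finset.sum_insert he,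
      ← ih fun f hf => h f (Finset.mem_insert_of_mem hf)]
    have hc := h e (Finset.mem_insert_self e E)
    have step : ∀ S ∈ E.powerset,
        subsetWeight (insert e E) a S * splitSum (insert e E) c d S ^ 2 +
          subsetWeight (insert e E) a (insert e S) * splitSum (insert e E) c d (insert e S) ^ 2 =
        subsetWeight E a S * (a e * c e ^ 2 + (1 - a e) * d e ^ 2) +
          subsetWeight E a S * splitSum E c d S ^ 2 := by
      intro S hS
      have hS' := Finset.mem_powerset.1 hS
      have heS : e ∉ S := fun h' => he (hS' h')
      have hd1 : insert e E \ S = insert e (E \ S) := Finset.insert_sdiff_of_notMem _ heS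
      have hd2 : insert e E \ insert e S = E \ S := by
        ext f; simp only [Finset.mem_sdiff, Finset.mem_insert]
        constructor
        · rintro ⟨h1 | h1, h2⟩
          · exact absurd (Or.inl h1) h2
          · exact ⟨h1, fun h3 => h2 (Or.inr h3)⟩
        · rintro ⟨h1, h2⟩
          refine ⟨Or.inr h1, ?_⟩
          rintro (rfl | h3)
          · exact he h1
          · exact h2 h3
      have heE : e ∉ E \ S := fun h' => he (Finset.mem_sdiff.1 h').1
      simp only [subsetWeight, splitSum, hd1, hd2, Finset.prod_insert heS,
        Finset.prod_insert heE, Finset.sum_insert heS, Finset.sum_insert heE]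
      generalize (∏ f ∈ S, a f) = x
      generalize (∏ f ∈ E \ S, (1 - a f)) = y
      generalize (∑ f ∈ S, c f) = u
      generalize (∑ f ∈ E \ S, d f) = v
      linear_combination (2 * x * y * (u + v)) * hc
    rw [Finset.sum_congr rfl step, Finset.sum_add_distrib, ← Finset.sum_mul, sum_subsetWeight,
      one_mul]

/-- Chebyshev's inequality for a sum of independent centred variables. -/
lemma sum_subsetWeight_splitSum_gt_le {E : Finset α} {a c d : α → ℝ}
    (h0 : ∀ f ∈ E, 0 ≤ a f) (h1 : ∀ f ∈ E, a f ≤ 1)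
    (h : ∀ f ∈ E, a f * c f + (1 - a f) * d f = 0) {v t : ℝ} (ht : 0 < t)
    (hv : ∀ f ∈ E, a f * c f ^ 2 + (1 - a f) * d f ^ 2 ≤ v) :
    ∑ S ∈ E.powerset with t < |splitSum E c d S|, subsetWeight E a S ≤ E.card * v / t ^ 2 := by
  rw [le_div_iff₀ (by positivity), Finset.sum_mul]
  calc ∑ S ∈ E.powerset with t < |splitSum E c d S|, subsetWeight E a S * t ^ 2
      ≤ ∑ S ∈ E.powerset with t < |splitSum E c d S|,
          subsetWeight E a S * splitSum E c d S ^ 2 := by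
        refine Finset.sum_le_sum fun S hS => ?_
        rw [Finset.mem_filter, Finset.mem_powerset] at hS
        refine mul_le_mul_of_nonneg_left ?_ (subsetWeight_nonneg hS.1 h0 h1)
        rw [← sq_abs (splitSum E c d S)]
        exact pow_le_pow_left₀ ht.le hS.2.le 2
    _ ≤ ∑ S ∈ E.powerset, subsetWeight E a S * splitSum E c d S ^ 2 := by
        refine Finset.sum_le_sum_of_subset_of_nonneg (Finset.filter_subset _ _) fun S hS _ => ?_
        exact mul_nonneg (subsetWeight_nonneg (Finset.mem_powerset.1 hS) h0 h1) (sq_nonneg _)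
    _ ≤ E.card * v := by
        rw [sum_subsetWeight_mul_splitSum_sq E a c d h, ← nsmul_eq_mul]
        exact Finset.sum_le_card_nsmul _ _ _ hv

lemma mul_log_sq_le {x : ℝ} (h0 : 0 ≤ x) (h1 : x ≤ 1) : x * Real.log x ^ 2 ≤ 4 := by
  rcases h0.eq_or_lt with rfl | hx
  · simp
  have hs : 0 < √x := Real.sqrt_pos.2 hx
  have hlog : Real.log x = 2 * Real.log √x := by
    rw [Real.log_sqrt hx.le]; ring
  have hneg : Real.log √x ≤ 0 := Real.log_nonpos hs.le (Real.sqrt_le_one.2 h1)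
  have hlow : 1 - (√x)⁻¹ ≤ Real.log √x := Real.one_sub_inv_le_log_of_pos hs
  have hprod : -1 ≤ √x * Real.log √x := by
    have := mul_le_mul_of_nonneg_left hlow hs.le
    rw [mul_sub, mul_inv_cancel₀ hs.ne'] at this
    linarith
  have hprod' : √x * Real.log √x ≤ 0 := mul_nonpos_of_nonneg_of_nonpos hs.le hneg
  have : x * Real.log x ^ 2 = 4 * (√x * Real.log √x) ^ 2 := by
    rw [hlog, mul_pow, mul_pow, Real.sq_sqrt hx.le]; ring
  rw [this]
  nlinarith

/-- Up to probability `9 #E / t²` the random set has size within `t` of its mean, and a probability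
at most `e^t` times the typical value `exp (-∑ binEntropy)`. So a family that is not too improbable
contains many sets of nearly the mean size. -/
lemma le_card_filter_of_subsetWeight {E : Finset α} {a : α → ℝ}
    (h0 : ∀ f ∈ E, 0 ≤ a f) (h1 : ∀ f ∈ E, a f ≤ 1) {t : ℝ} (ht : 0 < t)
    {T : Finset (Finset α)} (hT : T ⊆ E.powerset) :
    (∑ S ∈ T, subsetWeight E a S - 9 * E.card / t ^ 2) *
        Real.exp (∑ f ∈ E, Real.binEntropy (a f) - t) ≤
      ({S ∈ T | |(S.card : ℝ) - ∑ f ∈ E, a f| ≤ t}.card : ℝ) := by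
  set h : ℝ := ∑ f ∈ E, Real.binEntropy (a f) with hh
  set c : α → ℝ := fun f => Real.log (a f) + Real.binEntropy (a f) with hc
  set d : α → ℝ := fun f => Real.log (1 - a f) + Real.binEntropy (a f) with hd
  set c' : α → ℝ := fun f => 1 - a f with hc'
  set d' : α → ℝ := fun f => - a f with hd'
  have hbin : ∀ x : ℝ, Real.binEntropy x = -(x * Real.log x) - (1 - x) * Real.log (1 - x) := by
    intro x; rw [Real.binEntropy, Real.log_inv, Real.log_inv]; ring
  have cheb1 := sum_subsetWeight_splitSum_gt_le (c := c) (d := d) h0 h1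
    (fun f _ => by simp only [hc, hd, hbin]; ring) ht (v := 8) (fun f hf => by
      have e1 := mul_log_sq_le (h0 f hf) (h1 f hf)
      have e2 := mul_log_sq_le (sub_nonneg.2 (h1 f hf)) (sub_le_self 1 (h0 f hf))
      have e3 : a f * c f ^ 2 + (1 - a f) * d f ^ 2 = a f * Real.log (a f) ^ 2 +
          (1 - a f) * Real.log (1 - a f) ^ 2 - Real.binEntropy (a f) ^ 2 := by
        simp only [hc, hd, hbin]; ring
      rw [e3]
      nlinarith [sq_nonneg (Real.binEntropy (a f))])
  have cheb2 := sum_subsetWeight_splitSum_gt_le (c := c') (d := d') h0 h1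
    (fun f _ => by simp only [hc', hd']; ring) ht (v := 1) (fun f hf => by
      simp only [hc', hd']; nlinarith [h0 f hf, h1 f hf])
  have hsplit : ∀ {c d : α → ℝ} {S : Finset α}, S ⊆ E →
      splitSum E c d S = ∑ f ∈ S, (c f - d f) + ∑ f ∈ E, d f := by
    intro c d S hS
    rw [splitSum, ← Finset.sum_sdiff hS, Finset.sum_sub_distrib]; ring
  have hcard : ∀ S ⊆ E, splitSum E c' d' S = S.card - ∑ f ∈ E, a f := by
    intro S hS
    rw [hsplit hS]
    simp [hc', hd', sub_eq_add_neg]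
  set G := {S ∈ T | |(S.card : ℝ) - ∑ f ∈ E, a f| ≤ t} with hG
  set G' := {S ∈ G | |splitSum E c d S| ≤ t} with hG'
  have hmass : ∑ S ∈ T, subsetWeight E a S - 9 * E.card / t ^ 2 ≤
      ∑ S ∈ G', subsetWeight E a S := by
    have hsub : T ⊆ G' ∪ ({S ∈ E.powerset | t < |splitSum E c d S|} ∪
        {S ∈ E.powerset | t < |splitSum E c' d' S|}) := by
      intro S hS
      have hSE := hT hS
      simp only [Finset.mem_union, Finset.mem_filter, hG', hG]
      rw [hcard S (Finset.mem_powerset.1 hSE)]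
      by_cases q1 : |splitSum E c d S| ≤ t <;>
        by_cases q2 : |(S.card : ℝ) - ∑ f ∈ E, a f| ≤ t
      · exact Or.inl ⟨⟨hS, q2⟩, q1⟩
      · exact Or.inr (Or.inr ⟨hSE, not_le.1 q2⟩)
      · exact Or.inr (Or.inl ⟨hSE, not_le.1 q1⟩)
      · exact Or.inr (Or.inl ⟨hSE, not_le.1 q1⟩)
    have hnn : ∀ S ∈ G' ∪ ({S ∈ E.powerset | t < |splitSum E c d S|} ∪
        {S ∈ E.powerset | t < |splitSum E c' d' S|}), 0 ≤ subsetWeight E a S := by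
      intro S hS
      refine subsetWeight_nonneg (Finset.mem_powerset.1 ?_) h0 h1
      rcases Finset.mem_union.1 hS with h' | h'
      · exact hT (Finset.mem_filter.1 (Finset.mem_filter.1 h').1).1
      · rcases Finset.mem_union.1 h' with h' | h' <;> exact (Finset.mem_filter.1 h').1
    have hU : ∀ A B : Finset (Finset α), (∀ S ∈ A ∪ B, 0 ≤ subsetWeight E a S) →
        ∑ S ∈ A ∪ B, subsetWeight E a S ≤
          ∑ S ∈ A, subsetWeight E a S + ∑ S ∈ B, subsetWeight E a S := by
      intro A B hAB
      rw [← Finset.sum_union_inter]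
      refine le_add_of_nonneg_right (Finset.sum_nonneg fun S hS => hAB S ?_)
      exact Finset.mem_union_left _ (Finset.mem_inter.1 hS).1
    have l1 := Finset.sum_le_sum_of_subset_of_nonneg hsub fun S hS _ => hnn S hS
    have l2 := hU _ _ hnn
    have l3 := hU _ _ fun S hS => hnn S (Finset.mem_union_right _ hS)
    have l4 : (9 * E.card / t ^ 2 : ℝ) = E.card * 8 / t ^ 2 + E.card * 1 / t ^ 2 := by ring
    linarith
  have hweight : ∀ S ∈ G', subsetWeight E a S ≤ Real.exp (t - h) := by
    intro S hS
    have hS1 := Finset.mem_filter.1 hS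
    have hSE : S ⊆ E := Finset.mem_powerset.1 (hT (Finset.mem_filter.1 hS1.1).1)
    have hnn := subsetWeight_nonneg hSE h0 h1
    rcases hnn.eq_or_lt with h' | h'
    · rw [← h']; exact (Real.exp_pos _).le
    rw [← Real.log_le_iff_le_exp h']
    have hne1 : ∀ f ∈ S, a f ≠ 0 := fun f hf h'' => by
      rw [subsetWeight, Finset.prod_eq_zero hf h'', zero_mul] at h'; exact h'.false
    have hne2 : ∀ f ∈ E \ S, 1 - a f ≠ 0 := fun f hf h'' => by
      rw [subsetWeight, Finset.prod_eq_zero hf h'', mul_zero] at h'; exact h'.false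
    rw [subsetWeight, Real.log_mul (Finset.prod_ne_zero_iff.2 hne1)
      (Finset.prod_ne_zero_iff.2 hne2), Real.log_prod hne1, Real.log_prod hne2]
    have := (abs_le.1 hS1.2).2
    rw [splitSum, Finset.sum_add_distrib, Finset.sum_add_distrib] at this
    have h3 := Finset.sum_sdiff (f := fun f => Real.binEntropy (a f)) hSE
    linarith
  have hcount : ∑ S ∈ G', subsetWeight E a S ≤ G.card * Real.exp (t - h) := by
    calc ∑ S ∈ G', subsetWeight E a S ≤ G'.card • Real.exp (t - h) :=
          Finset.sum_le_card_nsmul _ _ _ hweight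
      _ = G'.card * Real.exp (t - h) := nsmul_eq_mul _ _
      _ ≤ G.card * Real.exp (t - h) := by
          have := Finset.card_le_card (Finset.filter_subset (fun S => |splitSum E c d S| ≤ t) G)
          gcongr
  have hexp : Real.exp (t - h) * Real.exp (h - t) = 1 := by
    rw [← Real.exp_add]; simp
  calc _ ≤ (G.card * Real.exp (t - h)) * Real.exp (h - t) :=
        mul_le_mul_of_nonneg_right (hmass.trans hcount) (Real.exp_pos _).le
    _ = G.card := by rw [mul_assoc, hexp, mul_one]

/-- Every set of size within `d` of `m` can be changed in at most `d` places into one of size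
exactly `m`; not many sets are changed into the same one. -/
lemma card_le_mul_card_near {E : Finset α} {m d : ℕ} (hm : m ≤ E.card) (hE : 1 ≤ E.card)
    {T : Finset (Finset α)} (hT : T ⊆ E.powerset)
    (hd : ∀ S ∈ T, S.card ≤ m + d ∧ m ≤ S.card + d) :
    T.card ≤ ((d + 1) * E.card ^ d) *
      {S' ∈ E.powersetCard m | ∃ S ∈ T, (S \ S').card ≤ d}.card := by
  have hex : ∀ S ∈ T, ∃ S' ∈ E.powersetCard m, (symmDiff S S').card ≤ d := by
    intro S hS
    have hSE := Finset.mem_powerset.1 (hT hS)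
    obtain ⟨h1, h2⟩ := hd S hS
    rcases le_total m S.card with hmS | hmS
    · obtain ⟨S', hsub, hcard⟩ := Finset.exists_subset_card_eq hmS
      refine ⟨S', Finset.mem_powersetCard.2 ⟨hsub.trans hSE, hcard⟩, ?_⟩
      rw [symmDiff_of_ge hsub, Finset.card_sdiff_of_subset hsub]; omega
    · obtain ⟨S', hsub, hsub', hcard⟩ := Finset.exists_subsuperset_card_eq hSE hmS hm
      refine ⟨S', Finset.mem_powersetCard.2 ⟨hsub', hcard⟩, ?_⟩
      rw [symmDiff_of_le hsub, Finset.card_sdiff_of_subset hsub]; omega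
  choose! φ hφ1 hφ2 using hex
  have himg : T.image φ ⊆ {S' ∈ E.powersetCard m | ∃ S ∈ T, (S \ S').card ≤ d} := by
    intro S' hS'
    obtain ⟨S, hS, rfl⟩ := Finset.mem_image.1 hS'
    exact Finset.mem_filter.2 ⟨hφ1 S hS, S, hS,
      (Finset.card_le_card le_sup_left).trans (hφ2 S hS)⟩
  refine (Finset.card_le_mul_card_image T ((d + 1) * E.card ^ d) fun S' hS' => ?_).trans
    (Nat.mul_le_mul_left _ (Finset.card_le_card himg))
  have hsmall : ((Finset.range (d + 1)).biUnion fun k => E.powersetCard k).card ≤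
      (d + 1) * E.card ^ d := by
    refine Finset.card_biUnion_le.trans ?_
    calc ∑ k ∈ Finset.range (d + 1), (E.powersetCard k).card
        ≤ ∑ k ∈ Finset.range (d + 1), E.card ^ d := by
          refine Finset.sum_le_sum fun k hk => ?_
          rw [Finset.card_powersetCard]
          exact (Nat.choose_le_pow _ _).trans
            (Nat.pow_le_pow_right hE (Nat.lt_succ_iff.1 (Finset.mem_range.1 hk)))
      _ = _ := by simp
  refine le_trans (Finset.card_le_card_of_injOn (fun S => symmDiff S S') ?_ ?_) hsmall
  · intro S hS
    obtain ⟨hST, rfl⟩ := Finset.mem_filter.1 (Finset.mem_coe.1 hS)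
    simp only [Finset.coe_biUnion, Set.mem_iUnion, Finset.mem_coe]
    refine ⟨_, Finset.mem_range.2 (Nat.lt_succ_iff.2 (hφ2 S hST)),
      Finset.mem_powersetCard.2 ⟨?_, rfl⟩⟩
    have := (Finset.mem_powersetCard.1 (hφ1 S hST)).1
    exact symmDiff_le_sup.trans (sup_le (Finset.mem_powerset.1 (hT hST)) this)
  · intro S _ R _ h
    exact symmDiff_left_injective S' h

end BernoulliSubsets

/-! ### Homomorphism densities of weights on unordered pairs -/

section PairDensity

variable {V : Type*} [Fintype V] [DecidableEq V] {n : ℕ}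

/-- The density of `H` in a weight function on the unordered pairs of elements of `Fin n`: the
average over the maps `x : V → Fin n` of the product of the weights of the images of the edges. -/
noncomputable def pairDensity (H : SimpleGraph V) [Fintype H.edgeSet]
    (w : Sym2 (Fin n) → ℝ) : ℝ :=
  (∑ x : V → Fin n, ∏ e ∈ H.edgeFinset, w (e.map x)) / (n : ℝ) ^ Fintype.card V

lemma pairDensity_le_one (H : SimpleGraph V) [Fintype H.edgeSet] {w : Sym2 (Fin n) → ℝ}
    (h0 : ∀ f, 0 ≤ w f) (h1 : ∀ f, w f ≤ 1) : pairDensity H w ≤ 1 := by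
  refine div_le_one_of_le₀ ?_ (by positivity)
  calc ∑ x : V → Fin n, ∏ e ∈ H.edgeFinset, w (e.map x) ≤ ∑ x : V → Fin n, (1 : ℝ) :=
        Finset.sum_le_sum fun x _ => Finset.prod_le_one (fun _ _ => h0 _) fun _ _ => h1 _
    _ = (n : ℝ) ^ Fintype.card V := by simp

lemma exists_abs_sum_mul_le {ι : Type*} (s : Finset ι) (f L : ι → ℝ)
    (h0 : ∀ i, 0 ≤ f i) (h1 : ∀ i, f i ≤ 1) :
    ∃ S ⊆ s, |∑ i ∈ s, f i * L i| ≤ |∑ i ∈ S, L i| := by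
  classical
  have key : ∀ L : ι → ℝ, ∑ i ∈ s, f i * L i ≤ ∑ i ∈ s with 0 ≤ L i, L i := by
    intro L
    rw [Finset.sum_filter]
    refine Finset.sum_le_sum fun i _ => ?_
    split_ifs with h
    · exact mul_le_of_le_one_left h (h1 i)
    · exact mul_nonpos_of_nonneg_of_nonpos (h0 i) (not_le.1 h).le
  rcases le_total 0 (∑ i ∈ s, f i * L i) with h | h
  · refine ⟨_, Finset.filter_subset (fun i => 0 ≤ L i) s, ?_⟩
    rw [abs_of_nonneg h]
    exact (key L).trans (le_abs_self _)
  · refine ⟨_, Finset.filter_subset (fun i => 0 ≤ -L i) s, ?_⟩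
    rw [abs_of_nonpos h, ← abs_neg (∑ i ∈ s with _, L i), ← Finset.sum_neg_distrib,
      ← Finset.sum_neg_distrib]
    simp only [← mul_neg]
    exact (key fun i => -L i).trans (le_abs_self _)

/-- A bound for the sums of `D` over all rectangles bounds its bilinear form on functions with
values in `[0,1]`, since these are convex combinations of indicator functions. -/
lemma abs_sum_mul_mul_le_of_cut {D : Sym2 (Fin n) → ℝ} {C : ℝ}
    (hD : ∀ S T : Finset (Fin n), |∑ i ∈ S, ∑ j ∈ T, D s(i, j)| ≤ C) (f g : Fin n → ℝ)
    (hf0 : ∀ i, 0 ≤ f i) (hf1 : ∀ i, f i ≤ 1) (hg0 : ∀ i, 0 ≤ g i) (hg1 : ∀ i, g i ≤ 1) :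
    |∑ i, ∑ j, D s(i, j) * (f i * g j)| ≤ C := by
  obtain ⟨S, -, hS⟩ := exists_abs_sum_mul_le Finset.univ f (fun i => ∑ j, D s(i, j) * g j) hf0 hf1
  obtain ⟨T, -, hT⟩ := exists_abs_sum_mul_le Finset.univ g (fun j => ∑ i ∈ S, D s(i, j)) hg0 hg1
  have e1 : ∑ i, ∑ j, D s(i, j) * (f i * g j) = ∑ i, f i * ∑ j, D s(i, j) * g j := by
    refine Finset.sum_congr rfl fun i _ => ?_
    rw [Finset.mul_sum]
    exact Finset.sum_congr rfl fun j _ => by ring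
  have e2 : ∑ i ∈ S, ∑ j, D s(i, j) * g j = ∑ j, g j * ∑ i ∈ S, D s(i, j) := by
    rw [Finset.sum_comm]
    refine Finset.sum_congr rfl fun j _ => ?_
    rw [Finset.mul_sum]
    exact Finset.sum_congr rfl fun i _ => by ring
  rw [e1]
  refine hS.trans ?_
  rw [e2]
  refine hT.trans ?_
  rw [Finset.sum_comm]
  exact hD S T

lemma sum_sum_update (F : (V → Fin n) → ℝ) (u : V) :
    ∑ x, ∑ a, F (Function.update x u a) = n * ∑ x, F x := by
  let φ : (V → Fin n) × Fin n → (V → Fin n) × Fin n := fun z => (Function.update z.1 u z.2, z.1 u)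
  have hφ : Function.Involutive φ := fun z => by simp [φ]
  rw [← Fintype.sum_prod_type' (f := fun (x : V → Fin n) a => F (Function.update x u a)),
    Fintype.sum_equiv hφ.toPerm (fun z => F (Function.update z.1 u z.2)) (fun z => F z.1)
      (fun z => rfl), Fintype.sum_prod_type]
  simp [Finset.mul_sum]

/-- With all coordinates but those of the ends of `e₀` fixed, the product over the other edges
splits into a function of one end and a function of the other. -/
lemma abs_sum_mul_prod_erase_le {D : Sym2 (Fin n) → ℝ} {C : ℝ}
    (hD : ∀ S T : Finset (Fin n), |∑ i ∈ S, ∑ j ∈ T, D s(i, j)| ≤ C)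
    (A : Finset (Sym2 V)) (U : Sym2 V → Sym2 (Fin n) → ℝ)
    (hU0 : ∀ e f, 0 ≤ U e f) (hU1 : ∀ e f, U e f ≤ 1) {e₀ : Sym2 V} (he₀ : ¬ e₀.IsDiag) :
    (n : ℝ) ^ 2 * |∑ x : V → Fin n, D (e₀.map x) * ∏ e ∈ A.erase e₀, U e (e.map x)| ≤
      (n : ℝ) ^ Fintype.card V * C := by
  induction e₀ using Sym2.ind with
  | _ u v =>
  rw [Sym2.mk_isDiag_iff] at he₀
  set F : (V → Fin n) → ℝ := fun x => D (s(u, v).map x) * ∏ e ∈ A.erase s(u, v), U e (e.map x)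
  have hF : (n : ℝ) ^ 2 * ∑ x, F x =
      ∑ x, ∑ a, ∑ b, F (Function.update (Function.update x u a) v b) := by
    have h1 := sum_sum_update (fun x => ∑ b, F (Function.update x v b)) u
    have h2 := sum_sum_update F v
    rw [h1, h2]; ring
  rw [← abs_of_nonneg (sq_nonneg (n : ℝ)), ← abs_mul, hF]
  refine (Finset.abs_sum_le_sum_abs _ _).trans ?_
  have hx : ∀ x : V → Fin n,
      |∑ a, ∑ b, F (Function.update (Function.update x u a) v b)| ≤ C := by
    intro x
    set B := A.erase s(u, v)
    set f : Fin n → ℝ := fun a => ∏ e ∈ B with u ∈ e, U e (e.map (Function.update x u a))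
    set g : Fin n → ℝ := fun b => ∏ e ∈ B with ¬ u ∈ e, U e (e.map (Function.update x v b))
    have hsplit : ∀ a b, F (Function.update (Function.update x u a) v b) =
        D s(a, b) * (f a * g b) := by
      intro a b
      simp only [F]
      rw [← Finset.prod_filter_mul_prod_filter_not B (fun e => u ∈ e)]
      congr 1
      · rw [Sym2.map_mk, Function.update_self, Function.update_of_ne he₀, Function.update_self]
      · congr 1
        · refine Finset.prod_congr rfl fun e he => ?_
          congr 1
          refine Sym2.map_congr fun z hz => ?_
          obtain ⟨heB, hue⟩ := Finset.mem_filter.1 he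
          have hzv : z ≠ v := by
            rintro rfl
            exact (Finset.mem_erase.1 heB).1 (((Sym2.mem_and_mem_iff he₀).1 ⟨hue, hz⟩))
          rw [Function.update_of_ne hzv]
        · refine Finset.prod_congr rfl fun e he => ?_
          congr 1
          refine Sym2.map_congr fun z hz => ?_
          obtain ⟨heB, hue⟩ := Finset.mem_filter.1 he
          have hzu : z ≠ u := by
            rintro rfl
            exact hue hz
          by_cases hzv : z = v
          · subst hzv; simp
          · simp [Function.update_of_ne hzv, Function.update_of_ne hzu]
    simp only [hsplit]
    exact abs_sum_mul_mul_le_of_cut hD f g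
      (fun a => Finset.prod_nonneg fun _ _ => hU0 _ _)
      (fun a => Finset.prod_le_one (fun _ _ => hU0 _ _) fun _ _ => hU1 _ _)
      (fun a => Finset.prod_nonneg fun _ _ => hU0 _ _)
      (fun a => Finset.prod_le_one (fun _ _ => hU0 _ _) fun _ _ => hU1 _ _)
  calc _ ≤ ∑ x : V → Fin n, C := Finset.sum_le_sum fun x _ => hx x
    _ = _ := by simp

/-- The counting lemma: densities of `H` are Lipschitz in the cut norm, with the number of edges
of `H` as constant. -/
lemma abs_pairDensity_sub_le (H : SimpleGraph V) [Fintype H.edgeSet] (hn : 0 < n)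
    {w w' : Sym2 (Fin n) → ℝ} (h0 : ∀ f, 0 ≤ w f) (h1 : ∀ f, w f ≤ 1)
    (h0' : ∀ f, 0 ≤ w' f) (h1' : ∀ f, w' f ≤ 1) {η : ℝ}
    (hD : ∀ S T : Finset (Fin n),
      |∑ i ∈ S, ∑ j ∈ T, (w s(i, j) - w' s(i, j))| ≤ η * (n : ℝ) ^ 2) :
    |pairDensity H w - pairDensity H w'| ≤ H.edgeFinset.card * η := by
  have hn' : (0 : ℝ) < n := Nat.cast_pos.2 hn
  have hpow : (0 : ℝ) < (n : ℝ) ^ Fintype.card V := by positivity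
  -- exchange `w'` for `w` edge by edge
  have key : ∀ A : Finset (Sym2 V), A ⊆ H.edgeFinset →
      |∑ x : V → Fin n, ∏ e ∈ H.edgeFinset, (if e ∈ A then w (e.map x) else w' (e.map x)) -
        ∑ x : V → Fin n, ∏ e ∈ H.edgeFinset, w' (e.map x)| ≤
      A.card * (η * (n : ℝ) ^ Fintype.card V) := by
    intro A
    induction A using Finset.induction_on with
    | empty => intro _; simp
    | insert e₀ A he₀ ih =>
      intro hA
      have ih' := ih fun e he => hA (Finset.mem_insert_of_mem he)
      have heH : e₀ ∈ H.edgeFinset := hA (Finset.mem_insert_self _ _)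
      have hdiag : ¬ e₀.IsDiag := H.not_isDiag_of_mem_edgeSet (SimpleGraph.mem_edgeFinset.1 heH)
      have step := abs_sum_mul_prod_erase_le (D := fun f => w f - w' f) hD H.edgeFinset
        (fun e f => if e ∈ A then w f else w' f)
        (fun e f => by split_ifs; exacts [h0 f, h0' f])
        (fun e f => by split_ifs; exacts [h1 f, h1' f]) hdiag
      have hdiff : ∑ x : V → Fin n, ∏ e ∈ H.edgeFinset,
            (if e ∈ insert e₀ A then w (e.map x) else w' (e.map x)) -
          ∑ x : V → Fin n, ∏ e ∈ H.edgeFinset, (if e ∈ A then w (e.map x) else w' (e.map x)) =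
          ∑ x : V → Fin n, (w (e₀.map x) - w' (e₀.map x)) *
            ∏ e ∈ H.edgeFinset.erase e₀, (if e ∈ A then w (e.map x) else w' (e.map x)) := by
        rw [← Finset.sum_sub_distrib]
        refine Finset.sum_congr rfl fun x _ => ?_
        rw [← Finset.mul_prod_erase _ _ heH, ← Finset.mul_prod_erase _ _ heH,
          if_pos (Finset.mem_insert_self _ _), if_neg he₀, sub_mul]
        congr 2
        refine Finset.prod_congr rfl fun e he => ?_
        simp [Finset.mem_insert, (Finset.mem_erase.1 he).1]
      rw [← hdiff] at step
      have hstep := le_of_mul_le_mul_left (step.trans_eq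
        (show _ = (n : ℝ) ^ 2 * (η * (n : ℝ) ^ Fintype.card V) by ring)) (by positivity)
      rw [Finset.card_insert_of_notMem he₀]
      push_cast
      have := abs_sub_le (∑ x : V → Fin n, ∏ e ∈ H.edgeFinset,
            (if e ∈ insert e₀ A then w (e.map x) else w' (e.map x)))
        (∑ x : V → Fin n, ∏ e ∈ H.edgeFinset, (if e ∈ A then w (e.map x) else w' (e.map x)))
        (∑ x : V → Fin n, ∏ e ∈ H.edgeFinset, w' (e.map x))
      linarith
  have h := key H.edgeFinset subset_rfl
  have hall : ∑ x : V → Fin n, ∏ e ∈ H.edgeFinset,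
      (if e ∈ H.edgeFinset then w (e.map x) else w' (e.map x)) =
      ∑ x : V → Fin n, ∏ e ∈ H.edgeFinset, w (e.map x) :=
    Finset.sum_congr rfl fun x _ => Finset.prod_congr rfl fun e he => if_pos he
  rw [hall] at h
  rw [pairDensity, pairDensity, ← sub_div, abs_div, abs_of_pos hpow, div_le_iff₀ hpow]
  linarith

/-- Removing `d` edges from a graph changes its density of `H` by at most `2 κ d / n²`. -/
lemma pairDensity_indicator_le_of_card_sdiff_le (H : SimpleGraph V) [Fintype H.edgeSet]
    (hn : 0 < n) {S S' : Finset (Sym2 (Fin n))} {d : ℕ} (hd : (S \ S').card ≤ d) :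
    pairDensity H (Set.indicator (S : Set (Sym2 (Fin n))) 1) -
        H.edgeFinset.card * (2 * d / (n : ℝ) ^ 2) ≤
      pairDensity H (Set.indicator (S' : Set (Sym2 (Fin n))) 1) := by
  classical
  have hn' : (0 : ℝ) < n := Nat.cast_pos.2 hn
  have hi0 : ∀ (R : Finset (Sym2 (Fin n))) f, 0 ≤ Set.indicator (R : Set (Sym2 (Fin n)))
      (1 : Sym2 (Fin n) → ℝ) f :=
    fun R f => Set.indicator_nonneg (fun _ _ => zero_le_one) f
  have hi1 : ∀ (R : Finset (Sym2 (Fin n))) f, Set.indicator (R : Set (Sym2 (Fin n)))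
      (1 : Sym2 (Fin n) → ℝ) f ≤ 1 :=
    fun R f => Set.indicator_le_self' (fun _ _ => zero_le_one) f
  have hmono : pairDensity H
      (Set.indicator ((S ∩ S' : Finset (Sym2 (Fin n))) : Set (Sym2 (Fin n))) 1) ≤
      pairDensity H (Set.indicator (S' : Set (Sym2 (Fin n))) 1) := by
    unfold pairDensity
    gcongr with x _ e _
    · exact fun _ _ => hi0 _ _
    · exact zero_le_one
    · exact Finset.inter_subset_right
  have hcut := abs_pairDensity_sub_le H hn (hi0 S) (hi1 S) (hi0 (S ∩ S')) (hi1 (S ∩ S'))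
    (η := 2 * d / (n : ℝ) ^ 2) (by
      intro A B
      rw [div_mul_cancel₀ _ (by positivity), ← Finset.sum_product']
      refine (Finset.abs_sum_le_sum_abs _ _).trans ?_
      have hterm : ∀ z ∈ A ×ˢ B,
          |Set.indicator (S : Set (Sym2 (Fin n))) (1 : Sym2 (Fin n) → ℝ) s(z.1, z.2) -
          Set.indicator ((S ∩ S' : Finset (Sym2 (Fin n))) : Set (Sym2 (Fin n))) 1 s(z.1, z.2)| =
          if s(z.1, z.2) ∈ S \ S' then 1 else 0 := by
        intro z _
        simp only [Set.indicator_apply, Finset.mem_coe, Finset.mem_inter, Finset.mem_sdiff,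
          Pi.one_apply]
        by_cases q1 : s(z.1, z.2) ∈ S <;> by_cases q2 : s(z.1, z.2) ∈ S' <;> simp [q1, q2]
      rw [Finset.sum_congr rfl hterm, Finset.sum_boole]
      have hfib := Finset.card_le_mul_card_image
        (f := fun z : Fin n × Fin n => s(z.1, z.2))
        {z ∈ A ×ˢ B | s(z.1, z.2) ∈ S \ S'} 2 (by
          intro f _
          induction f using Sym2.ind with
          | _ i j =>
          refine (Finset.card_le_card (t := {(i, j), (j, i)}) ?_).trans Finset.card_le_two
          rintro ⟨a, b⟩ hz
          have := (Finset.mem_filter.1 hz).2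
          simpa [Sym2.eq_iff] using this)
      have himg : (Finset.image (fun z : Fin n × Fin n => s(z.1, z.2))
          {z ∈ A ×ˢ B | s(z.1, z.2) ∈ S \ S'}).card ≤ d := by
        refine (Finset.card_le_card ?_).trans hd
        intro f hf
        obtain ⟨z, hz, rfl⟩ := Finset.mem_image.1 hf
        exact (Finset.mem_filter.1 hz).2
      exact_mod_cast hfib.trans (Nat.mul_le_mul_left 2 himg))
  have := (abs_le.1 hcut).2
  linarith

/-- The expected density of a random graph with independent edges is at least the density of its
matrix of edge probabilities: edges of `H` with the same image only help. -/
lemma pairDensity_le_sum_subsetWeight (H : SimpleGraph V) [Fintype H.edgeSet]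
    {E : Finset (Sym2 (Fin n))} {w : Sym2 (Fin n) → ℝ} (h0 : ∀ f, 0 ≤ w f) (h1 : ∀ f, w f ≤ 1)
    (hE : ∀ f ∉ E, w f = 0) :
    pairDensity H w ≤ ∑ S ∈ E.powerset, subsetWeight E w S *
      pairDensity H (Set.indicator (S : Set (Sym2 (Fin n))) 1) := by
  classical
  simp only [pairDensity, ← mul_div_assoc, ← Finset.sum_div, Finset.mul_sum]
  rw [Finset.sum_comm]
  gcongr with x _
  set F := H.edgeFinset.image fun e => e.map x with hF
  by_cases hFE : F ⊆ E
  · have hind : ∀ S : Finset (Sym2 (Fin n)), ∏ e ∈ H.edgeFinset,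
        Set.indicator (S : Set (Sym2 (Fin n))) (1 : Sym2 (Fin n) → ℝ) (e.map x) =
        if F ⊆ S then 1 else 0 := by
      intro S
      split_ifs with h
      · refine Finset.prod_eq_one fun e he => ?_
        rw [Set.indicator_of_mem (Finset.mem_coe.2 (h (Finset.mem_image_of_mem _ he)))]
        rfl
      · obtain ⟨f, hfF, hfS⟩ := Finset.not_subset.1 h
        obtain ⟨e, he, rfl⟩ := Finset.mem_image.1 hfF
        exact Finset.prod_eq_zero he (Set.indicator_of_notMem (by simpa using hfS) _)
    simp only [hind]
    rw [sum_subsetWeight_superset w hFE, Finset.prod_comp w fun e => Sym2.map x e]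
    refine Finset.prod_le_prod (fun f _ => pow_nonneg (h0 f) _) fun f hf => ?_
    obtain ⟨e, he, rfl⟩ := Finset.mem_image.1 hf
    refine pow_le_of_le_one (h0 _) (h1 _) (Finset.card_pos.2 ⟨e, ?_⟩).ne'
    exact Finset.mem_filter.2 ⟨he, rfl⟩
  · obtain ⟨f, hfF, hfE⟩ := Finset.not_subset.1 hFE
    obtain ⟨e, he, rfl⟩ := Finset.mem_image.1 hfF
    rw [Finset.prod_eq_zero he (hE _ hfE)]
    refine Finset.sum_nonneg fun S hS => mul_nonneg
      (subsetWeight_nonneg (Finset.mem_powerset.1 hS) (fun f _ => h0 f) fun f _ => h1 f) ?_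
    exact Finset.prod_nonneg fun e _ => Set.indicator_nonneg (fun _ _ => zero_le_one) _

end PairDensity

/-! ### Step graphons and graphs as weights on pairs -/

section Pairs

/-- The unordered pairs of distinct elements of `Fin n`. -/
def distinctPairs (n : ℕ) : Finset (Sym2 (Fin n)) := {f | ¬ f.IsDiag}

lemma mem_distinctPairs {n : ℕ} {f : Sym2 (Fin n)} : f ∈ distinctPairs n ↔ ¬ f.IsDiag := by
  simp [distinctPairs]

lemma card_distinctPairs (n : ℕ) : (distinctPairs n).card = n.choose 2 := by
  have h := Sym2.card_subtype_not_diag (α := Fin n)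
  rw [Fintype.card_fin, Fintype.card_subtype] at h
  rw [distinctPairs, ← h]

lemma sum_distinctPairs {n : ℕ} (φ : Sym2 (Fin n) → ℝ) :
    ∑ f ∈ distinctPairs n, φ f = ∑ i, ∑ j ∈ Finset.Ioi i, φ s(i, j) := by
  have h := Finset.sum_sym2_filter_not_isDiag Finset.univ φ
  rw [Finset.sym2_univ] at h
  rw [distinctPairs, h, Finset.sum_sigma']
  refine Finset.sum_bij' (fun z _ => ⟨z.1, z.2⟩) (fun z _ => (z.1, z.2)) ?_ ?_ ?_ ?_ ?_ <;>
    simp +contextual [ne_of_lt]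

lemma sum_sum_eq_diag_add_distinctPairs {n : ℕ} (φ : Sym2 (Fin n) → ℝ) :
    ∑ i, ∑ j, φ s(i, j) = ∑ i, φ s(i, i) + 2 * ∑ f ∈ distinctPairs n, φ f := by
  have h1 : ∀ i : Fin n, ∑ j, φ s(i, j) =
      φ s(i, i) + ∑ j ∈ Finset.Ioi i, φ s(i, j) + ∑ j ∈ Finset.Iio i, φ s(i, j) := by
    intro i
    have hu : (Finset.univ : Finset (Fin n)) =
        insert i (Finset.Ioi i ∪ Finset.Iio i) := by
      ext j; simp only [Finset.mem_univ, Finset.mem_insert, Finset.mem_union, Finset.mem_Ioi,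
        Finset.mem_Iio, true_iff]
      exact (lt_trichotomy j i).elim (fun h => Or.inr (Or.inr h))
        fun h => h.elim Or.inl fun h => Or.inr (Or.inl h)
    rw [hu, Finset.sum_insert (by simp), Finset.sum_union, add_assoc]
    exact Finset.disjoint_left.2 fun j h1 h2 =>
      lt_asymm (Finset.mem_Ioi.1 h1) (Finset.mem_Iio.1 h2)
  have h2 : ∑ i : Fin n, ∑ j ∈ Finset.Iio i, φ s(i, j) =
      ∑ i : Fin n, ∑ j ∈ Finset.Ioi i, φ s(i, j) := by
    rw [Finset.sum_comm' (t' := Finset.univ) (s' := fun j => Finset.Ioi j) (by simp)]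
    exact Finset.sum_congr rfl fun i _ => Finset.sum_congr rfl fun j _ => by rw [Sym2.eq_swap]
  simp only [h1, Finset.sum_add_distrib, h2, sum_distinctPairs]
  ring

/-- The weights of a weighted graph as a function on unordered pairs. -/
def EdgeWeightedGraph.pairWeight {n : ℕ} (A : EdgeWeightedGraph n) : Sym2 (Fin n) → ℝ :=
  Sym2.lift ⟨A.weight, A.symm'⟩

/-- The weighted graph with the given weights on pairs of distinct vertices. -/
def EdgeWeightedGraph.ofPairWeight {n : ℕ} (w : Sym2 (Fin n) → ℝ) (h0 : ∀ f, 0 ≤ w f)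
    (h1 : ∀ f, w f ≤ 1) (hE : ∀ f ∉ distinctPairs n, w f = 0) : EdgeWeightedGraph n where
  weight i j := w s(i, j)
  symm' i j := by rw [Sym2.eq_swap]
  diag' i := hE _ (by simp [mem_distinctPairs])
  nonneg' i j := h0 _
  le_one' i j := h1 _

lemma EdgeWeightedGraph.pairWeight_ofPairWeight {n : ℕ} (w : Sym2 (Fin n) → ℝ)
    (h0 : ∀ f, 0 ≤ w f) (h1 : ∀ f, w f ≤ 1) (hE : ∀ f ∉ distinctPairs n, w f = 0) :
    (EdgeWeightedGraph.ofPairWeight w h0 h1 hE).pairWeight = w := by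
  funext f
  induction f using Sym2.ind with
  | _ i j => rfl

variable {n : ℕ} (A : EdgeWeightedGraph n)

lemma EdgeWeightedGraph.pairWeight_nonneg (f : Sym2 (Fin n)) : 0 ≤ A.pairWeight f := by
  induction f using Sym2.ind with
  | _ i j => exact A.nonneg' i j

lemma EdgeWeightedGraph.pairWeight_le_one (f : Sym2 (Fin n)) : A.pairWeight f ≤ 1 := by
  induction f using Sym2.ind with
  | _ i j => exact A.le_one' i j

lemma EdgeWeightedGraph.pairWeight_eq_zero {f : Sym2 (Fin n)} (hf : f ∉ distinctPairs n) :
    A.pairWeight f = 0 := by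
  induction f using Sym2.ind with
  | _ i j =>
    rw [mem_distinctPairs, not_not, Sym2.mk_isDiag_iff] at hf
    subst hf
    exact A.diag' i

lemma EdgeWeightedGraph.sum_pairWeight :
    ∑ f ∈ distinctPairs n, A.pairWeight f = ∑ i, ∑ j ∈ Finset.Ioi i, A.weight i j :=
  sum_distinctPairs _

/-- The index of the cell that contains `x`; the point `0`, which lies in no cell, gets the
index `0`. -/
noncomputable def cellIndex (n : ℕ) [NeZero n] (x : unitInterval) : Fin n :=
  ⟨⌈(n : ℝ) * (x : ℝ)⌉₊ - 1, by
    have h : ⌈(n : ℝ) * (x : ℝ)⌉₊ ≤ n :=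
      Nat.ceil_le.2 (mul_le_of_le_one_right (Nat.cast_nonneg n) x.2.2)
    have := NeZero.pos n
    omega⟩

lemma measurable_cellIndex (n : ℕ) [NeZero n] : Measurable (cellIndex n) := by
  refine measurable_to_countable' fun i => ?_
  have h : Measurable fun x : unitInterval => ⌈(n : ℝ) * (x : ℝ)⌉₊ - 1 :=
    (measurable_from_top (f := fun k : ℕ => k - 1)).comp
      (Nat.measurable_ceil.comp (measurable_subtype_coe.const_mul _))
  convert h (measurableSet_singleton (i : ℕ)) using 1
  ext x
  simp [cellIndex, Fin.ext_iff]

lemma mem_cell_iff [NeZero n] {x : unitInterval} (hx : x ≠ 0) (i : Fin n) :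
    x ∈ cell n i ↔ cellIndex n x = i := by
  have hpos : 0 < (n : ℝ) * (x : ℝ) :=
    mul_pos (Nat.cast_pos.2 (NeZero.pos n)) (unitInterval.pos_iff_ne_zero.2 hx)
  have := Nat.ceil_pos.2 hpos
  simp only [cell, Set.mem_ofPred_eq, cellIndex, Fin.ext_iff]
  omega

lemma volume_cellIndex_eq [NeZero n] (i : Fin n) :
    volume.real (cellIndex n ⁻¹' {i}) = 1 / n := by
  have hn : (0 : ℝ) < n := Nat.cast_pos.2 (NeZero.pos n)
  have hi : ((i : ℕ) : ℝ) + 1 ≤ n := by exact_mod_cast i.2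
  have hae : cellIndex n ⁻¹' {i} =ᵐ[volume] cell n i := by
    have h0 : ∀ᵐ x : unitInterval, x ≠ 0 := by
      rw [ae_iff]; simp
    filter_upwards [h0] with x hx
    exact propext (mem_cell_iff hx i).symm
  have hcell : cell n i = Set.Ioc (⟨i / n, by positivity, (div_le_one hn).2 (by linarith)⟩ :
      unitInterval) ⟨(i + 1) / n, by positivity, (div_le_one hn).2 hi⟩ := by
    ext x
    simp only [cell, Set.mem_ofPred_eq, Set.mem_Ioc, ← Subtype.coe_lt_coe, ← Subtype.coe_le_coe]
    rw [Nat.ceil_eq_iff (by omega), div_lt_iff₀ hn, le_div_iff₀ hn, mul_comm]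
    simp
  rw [measureReal_congr hae, hcell, measureReal_def, unitInterval.volume_Ioc,
    ENNReal.toReal_ofReal]
  · simp only; field_simp; ring
  · simp only; rw [← sub_div]; exact div_nonneg (by linarith) hn.le

lemma EdgeWeightedGraph.graphon_apply [NeZero n] {x y : unitInterval} (hx : x ≠ 0) (hy : y ≠ 0) :
    A.graphon.toFun x y = A.weight (cellIndex n x) (cellIndex n y) := by
  change A.stepFun x y = _
  unfold EdgeWeightedGraph.stepFun
  simp only [mem_cell_iff hx, mem_cell_iff hy]
  rw [Finset.sum_eq_single (cellIndex n x), Finset.sum_eq_single (cellIndex n y)]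
  · simp
  · intro j _ hj; rw [if_neg]; exact fun h => hj h.2.symm
  · simp
  · intro i _ hi
    exact Finset.sum_eq_zero fun j _ => if_neg fun h => hi h.1.symm
  · simp

lemma EdgeWeightedGraph.homDensity_graphon {V : Type*} [Fintype V] [DecidableEq V]
    (H : SimpleGraph V) [Fintype H.edgeSet] [NeZero n] :
    A.graphon.homDensity H = pairDensity H A.pairWeight := by
  set φ : (V → unitInterval) → (V → Fin n) := fun x v => cellIndex n (x v) with hφ
  set F : (V → Fin n) → ℝ := fun y => ∏ e ∈ H.edgeFinset, A.pairWeight (e.map y) with hF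
  have hae : ∀ᵐ x : V → unitInterval, ∀ v, x v ≠ 0 := by
    rw [ae_all_iff]
    intro v
    have h0 : ∀ᵐ x : unitInterval, x ≠ 0 := by
      rw [ae_iff]; simp
    exact (measurePreserving_eval (fun _ : V => (volume : Measure unitInterval))
      v).quasiMeasurePreserving.ae h0
  have h1 : A.graphon.homDensity H = ∫ x, F (φ x) := by
    unfold Graphon.homDensity
    refine integral_congr_ae ?_
    filter_upwards [hae] with x hx
    refine Finset.prod_congr rfl fun e _ => ?_
    induction e using Sym2.ind with
    | _ u v => exact A.graphon_apply (hx u) (hx v)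
  have hφm : Measurable φ :=
    measurable_pi_lambda _ fun v => (measurable_cellIndex n).comp (measurable_pi_apply v)
  have hmap : Measure.map φ volume =
      Measure.pi fun _ : V => Measure.map (cellIndex n) volume := by
    have : IsProbabilityMeasure (Measure.map (cellIndex n) volume) :=
      Measure.isProbabilityMeasure_map (measurable_cellIndex n).aemeasurable
    rw [volume_pi]
    exact Measure.pi_map_pi fun v => (measurable_cellIndex n).aemeasurable
  have : IsProbabilityMeasure (Measure.map (cellIndex n) volume) :=
    Measure.isProbabilityMeasure_map (measurable_cellIndex n).aemeasurable
  rw [h1, ← integral_map hφm.aemeasurable (measurable_of_finite F).aestronglyMeasurable, hmap,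
    integral_fintype Integrable.of_finite, pairDensity, Finset.sum_div]
  refine Finset.sum_congr rfl fun y _ => ?_
  have hy : (Measure.pi fun _ : V => Measure.map (cellIndex n) volume).real {y} =
      ((n : ℝ) ^ Fintype.card V)⁻¹ := by
    rw [measureReal_def, Measure.pi_singleton, ENNReal.toReal_prod]
    simp only [← measureReal_def,
      map_measureReal_apply (measurable_cellIndex n) (measurableSet_singleton _),
      volume_cellIndex_eq]
    simp
  rw [hy, smul_eq_mul, hF, div_eq_inv_mul]

lemma EdgeWeightedGraph.relEntropy_graphon [NeZero n] (p : ℝ) :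
    A.graphon.relEntropy p = (n * relEntropy p 0 +
      2 * ∑ f ∈ distinctPairs n, relEntropy p (A.pairWeight f)) / (n : ℝ) ^ 2 := by
  set φ : unitInterval × unitInterval → Fin n × Fin n := Prod.map (cellIndex n) (cellIndex n)
    with hφ
  set F : Fin n × Fin n → ℝ := fun y => relEntropy p (A.weight y.1 y.2) with hF
  have h0 : ∀ᵐ x : unitInterval, x ≠ 0 := by
    rw [ae_iff]; simp
  have h1 : A.graphon.relEntropy p = ∫ z, F (φ z) := by
    unfold Graphon.relEntropy
    refine integral_congr_ae ?_
    have hfst : ∀ᵐ z : unitInterval × unitInterval, z.1 ≠ 0 :=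
      Measure.quasiMeasurePreserving_fst.ae h0
    have hsnd : ∀ᵐ z : unitInterval × unitInterval, z.2 ≠ 0 :=
      Measure.quasiMeasurePreserving_snd.ae h0
    filter_upwards [hfst, hsnd] with z hz1 hz2
    rw [A.graphon_apply hz1 hz2]
    rfl
  have hm := measurable_cellIndex n
  have : IsProbabilityMeasure (Measure.map (cellIndex n) volume) :=
    Measure.isProbabilityMeasure_map hm.aemeasurable
  have hmap : Measure.map φ volume =
      (Measure.map (cellIndex n) volume).prod (Measure.map (cellIndex n) volume) := by
    rw [Measure.volume_eq_prod, Measure.map_prod_map _ _ hm hm]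
  rw [h1, ← integral_map (hm.prodMap hm).aemeasurable
    (measurable_of_finite F).aestronglyMeasurable, hmap, integral_fintype Integrable.of_finite]
  have hy : ∀ y : Fin n × Fin n, ((Measure.map (cellIndex n) volume).prod
      (Measure.map (cellIndex n) volume)).real {y} = ((n : ℝ) ^ 2)⁻¹ := by
    rintro ⟨i, j⟩
    rw [← Set.singleton_prod_singleton, measureReal_prod_prod,
      map_measureReal_apply hm (measurableSet_singleton _),
      map_measureReal_apply hm (measurableSet_singleton _), volume_cellIndex_eq,
      volume_cellIndex_eq]
    simp [sq]
  simp only [hy, smul_eq_mul]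
  rw [← Finset.mul_sum, Fintype.sum_prod_type, div_eq_inv_mul]
  congr 1
  have := sum_sum_eq_diag_add_distinctPairs fun f => relEntropy p (A.pairWeight f)
  have hd : ∀ i, A.pairWeight s(i, i) = 0 := A.diag'
  simp only [hd] at this
  simpa [hF, EdgeWeightedGraph.pairWeight] using this

lemma graphHomDensity_eq_pairDensity {V : Type*} [Fintype V] [DecidableEq V]
    (H : SimpleGraph V) [Fintype H.edgeSet] (G : SimpleGraph (Fin n)) :
    graphHomDensity H G = pairDensity H (Set.indicator G.edgeSet 1) := by
  classical
  unfold graphHomDensity pairDensity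
  congr 1
  have hprod : ∀ x : V → Fin n, ∏ e ∈ H.edgeFinset,
      Set.indicator G.edgeSet (1 : Sym2 (Fin n) → ℝ) (e.map x) =
      if ∀ e ∈ H.edgeFinset, e.map x ∈ G.edgeSet then 1 else 0 := by
    intro x
    split_ifs with h
    · exact Finset.prod_eq_one fun e he => by rw [Set.indicator_of_mem (h e he)]; rfl
    · push Not at h
      obtain ⟨e, he, hx⟩ := h
      exact Finset.prod_eq_zero he (Set.indicator_of_notMem hx _)
  simp only [hprod]
  rw [Finset.sum_boole, ← Fintype.card_subtype, ← Nat.card_eq_fintype_card]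
  congr 1
  refine Nat.card_congr ⟨fun x => ⟨x, fun e he => ?_⟩, fun x => ⟨x.1, fun {u v} h => ?_⟩,
    fun x => rfl, fun x => rfl⟩
  · rw [SimpleGraph.mem_edgeFinset] at he
    induction e using Sym2.ind with
    | _ u v => exact x.map_rel he
  · exact x.2 s(u, v) (SimpleGraph.mem_edgeFinset.2 h)

/-- Every set of graphs on `Fin n` is measurable. -/
lemma measurableSet_simpleGraph (s : Set (SimpleGraph (Fin n))) : MeasurableSet s :=
  SimpleGraph.measurableEmbedding_edgeSet.measurableSet_image.1
    (Set.toFinite _).measurableSet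

lemma edgeSet_fromEdgeSet_of_subset {S : Finset (Sym2 (Fin n))} (hS : S ⊆ distinctPairs n) :
    (SimpleGraph.fromEdgeSet (S : Set (Sym2 (Fin n)))).edgeSet = S := by
  rw [SimpleGraph.edgeSet_fromEdgeSet]
  ext f
  simp only [Set.mem_sdiff, Finset.mem_coe, and_iff_left_iff_imp]
  exact fun hf => mem_distinctPairs.1 (hS hf)

lemma count_image_fromEdgeSet {F : Finset (Finset (Sym2 (Fin n)))}
    (hF : ∀ S ∈ F, S ⊆ distinctPairs n) :
    Measure.count ((fun S : Finset (Sym2 (Fin n)) =>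
      SimpleGraph.fromEdgeSet (S : Set (Sym2 (Fin n)))) '' F) = F.card := by
  rw [Measure.count_apply (measurableSet_simpleGraph _), Set.InjOn.encard_image,
    Set.encard_coe_eq_coe_finsetCard]
  · simp
  · intro S hS T hT h
    have := congrArg SimpleGraph.edgeSet h
    simp only [edgeSet_fromEdgeSet_of_subset (hF S hS),
      edgeSet_fromEdgeSet_of_subset (hF T hT)] at this
    exact Finset.coe_injective this

open Classical in
/-- The edge sets of the graphs on `Fin n` with `m` edges and `H`-density at least `t`. -/
noncomputable def denseEdgeSets {V : Type*} [Fintype V] [DecidableEq V] (H : SimpleGraph V)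
    [Fintype H.edgeSet] (n m : ℕ) (t : ℝ) : Finset (Finset (Sym2 (Fin n))) :=
  ((distinctPairs n).powersetCard m).filter fun S : Finset (Sym2 (Fin n)) =>
    t ≤ pairDensity H (Set.indicator (S : Set (Sym2 (Fin n))) 1)

/-- The probability that `G(n,m)` has `H`-density at least `t`, by counting sets of pairs. -/
lemma uniformGraph_graphHomDensity_ge {V : Type*} [Fintype V] [DecidableEq V]
    (H : SimpleGraph V) [Fintype H.edgeSet] (n m : ℕ) (t : ℝ) :
    uniformGraph n m {G | t ≤ graphHomDensity H G} =
      ((n.choose 2).choose m : ENNReal)⁻¹ *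
        ((denseEdgeSets H n m t).card : ENNReal) := by
  classical
  set φ := fun S : Finset (Sym2 (Fin n)) => SimpleGraph.fromEdgeSet (S : Set (Sym2 (Fin n)))
    with hφ
  have hsub : ∀ S ∈ (distinctPairs n).powersetCard m, S ⊆ distinctPairs n :=
    fun S hS => (Finset.mem_powersetCard.1 hS).1
  have hset : ∀ P : SimpleGraph (Fin n) → Prop,
      {G : SimpleGraph (Fin n) | G.edgeSet.ncard = m} ∩ {G | P G} =
      φ '' ({S ∈ (distinctPairs n).powersetCard m | P (φ S)} :
        Finset (Finset (Sym2 (Fin n)))) := by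
    intro P
    ext G
    simp only [Set.mem_inter_iff, Set.mem_ofPred_eq, Set.mem_image, Finset.mem_coe,
      Finset.mem_filter, Finset.mem_powersetCard]
    constructor
    · rintro ⟨hG, hP⟩
      have hGφ : φ G.edgeSet.toFinset = G := by simp [hφ]
      refine ⟨G.edgeSet.toFinset, ⟨⟨fun f hf => ?_, ?_⟩, ?_⟩, hGφ⟩
      · exact mem_distinctPairs.2 (G.not_isDiag_of_mem_edgeSet (Set.mem_toFinset.1 hf))
      · rw [← hG, Set.ncard_eq_toFinset_card']
      · rwa [hGφ]
    · rintro ⟨S, ⟨⟨hS, hm⟩, hP⟩, rfl⟩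
      refine ⟨?_, hP⟩
      rw [hφ, edgeSet_fromEdgeSet_of_subset hS, Set.ncard_coe_finset, hm]
  have huniv : {G : SimpleGraph (Fin n) | G.edgeSet.ncard = m} =
      φ '' ((distinctPairs n).powersetCard m) := by
    have := hset fun _ => True
    simpa using this
  rw [uniformGraph, uniformOn, cond_apply (measurableSet_simpleGraph _), hset, huniv,
    count_image_fromEdgeSet hsub,
    count_image_fromEdgeSet fun S hS => hsub S (Finset.filter_subset _ _ hS),
    Finset.card_powersetCard, card_distinctPairs]
  refine congrArg (fun k : ℕ => ((n.choose 2).choose m : ENNReal)⁻¹ * (k : ENNReal))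
    (congrArg Finset.card (Finset.filter_congr fun S hS => ?_))
  rw [graphHomDensity_eq_pairDensity, hφ, edgeSet_fromEdgeSet_of_subset (hsub S hS)]

end Pairs

/-! ### Averages over the blocks of a partition -/

section BlockAverage

variable {α L L' : Type*} [DecidableEq α] [DecidableEq L] [DecidableEq L']

/-- The mean of `a` over the elements of `E` with label `l` (and `0` if there are none). -/
noncomputable def blockMean (E : Finset α) (lab : α → L) (a : α → ℝ) (l : L) : ℝ :=
  (∑ f ∈ E with lab f = l, a f) / ({f ∈ E | lab f = l}.card : ℝ)

/-- The conditional expectation of `a` on `E` given the label, extended by `0` outside `E`. -/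
noncomputable def blockAverage (E : Finset α) (lab : α → L) (a : α → ℝ) (f : α) : ℝ :=
  if f ∈ E then blockMean E lab a (lab f) else 0

lemma blockAverage_of_mem {E : Finset α} {lab : α → L} {a : α → ℝ} {f : α} (hf : f ∈ E) :
    blockAverage E lab a f = blockMean E lab a (lab f) := if_pos hf

lemma blockAverage_of_notMem {E : Finset α} {lab : α → L} {a : α → ℝ} {f : α} (hf : f ∉ E) :
    blockAverage E lab a f = 0 := if_neg hf

lemma sum_blockAverage_mul (E : Finset α) (lab : α → L) (a : α → ℝ) (φ : L → ℝ) :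
    ∑ f ∈ E, blockAverage E lab a f * φ (lab f) = ∑ f ∈ E, a f * φ (lab f) := by
  rw [← Finset.sum_fiberwise_of_maps_to (t := E.image lab)
      (fun f hf => Finset.mem_image_of_mem lab hf),
    ← Finset.sum_fiberwise_of_maps_to (s := E) (t := E.image lab)
      (fun f hf => Finset.mem_image_of_mem lab hf) (fun f => a f * φ (lab f))]
  refine Finset.sum_congr rfl fun l hl => ?_
  obtain ⟨g, hg, rfl⟩ := Finset.mem_image.1 hl
  have hmem : g ∈ {f ∈ E | lab f = lab g} := Finset.mem_filter.2 ⟨hg, rfl⟩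
  have hcard : ({f ∈ E | lab f = lab g}.card : ℝ) ≠ 0 :=
    Nat.cast_ne_zero.2 (Finset.card_pos.2 ⟨g, hmem⟩).ne'
  have h1 : ∀ f ∈ {f ∈ E | lab f = lab g}, blockAverage E lab a f * φ (lab f) =
      blockMean E lab a (lab g) * φ (lab g) := by
    intro f hf
    obtain ⟨hfE, hfl⟩ := Finset.mem_filter.1 hf
    rw [blockAverage_of_mem hfE, hfl]
  have h2 : ∀ f ∈ {f ∈ E | lab f = lab g}, a f * φ (lab f) = a f * φ (lab g) := by
    intro f hf
    rw [(Finset.mem_filter.1 hf).2]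
  rw [Finset.sum_congr rfl h1, Finset.sum_congr rfl h2, ← Finset.sum_mul, Finset.sum_const,
    nsmul_eq_mul, blockMean, mul_div_cancel₀ _ hcard, Finset.sum_mul]

lemma sum_blockAverage (E : Finset α) (lab : α → L) (a : α → ℝ) :
    ∑ f ∈ E, blockAverage E lab a f = ∑ f ∈ E, a f := by
  simpa using sum_blockAverage_mul E lab a fun _ => 1

lemma blockAverage_nonneg {E : Finset α} {lab : α → L} {a : α → ℝ} (h : ∀ f, 0 ≤ a f) (f : α) :
    0 ≤ blockAverage E lab a f := by
  unfold blockAverage blockMean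
  split_ifs
  · exact div_nonneg (Finset.sum_nonneg fun f _ => h f) (Nat.cast_nonneg _)
  · exact le_rfl

lemma blockAverage_le_one {E : Finset α} {lab : α → L} {a : α → ℝ} (h : ∀ f, a f ≤ 1) (f : α) :
    blockAverage E lab a f ≤ 1 := by
  unfold blockAverage blockMean
  split_ifs
  · refine div_le_one_of_le₀ ?_ (Nat.cast_nonneg _)
    calc _ ≤ ∑ f ∈ E with lab f = _, (1 : ℝ) := Finset.sum_le_sum fun f _ => h f
      _ = _ := by simp
  · exact zero_le_one

lemma eq_zero_of_blockAverage_eq_zero {E : Finset α} {lab : α → L} {a : α → ℝ}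
    (h : ∀ f ∈ E, 0 ≤ a f) {f : α} (hf : f ∈ E) (h0 : blockAverage E lab a f = 0) : a f = 0 := by
  have hmem : f ∈ {g ∈ E | lab g = lab f} := Finset.mem_filter.2 ⟨hf, rfl⟩
  rw [blockAverage_of_mem hf, blockMean, div_eq_zero_iff] at h0
  rcases h0 with h0 | h0
  · exact (Finset.sum_eq_zero_iff_of_nonneg fun g hg => h g (Finset.mem_filter.1 hg).1).1 h0 f hmem
  · exact absurd h0 (Nat.cast_ne_zero.2 (Finset.card_pos.2 ⟨f, hmem⟩).ne')

lemma blockAverage_one_sub {E : Finset α} {lab : α → L} (a : α → ℝ) {f : α} (hf : f ∈ E) :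
    blockAverage E lab (fun g => 1 - a g) f = 1 - blockAverage E lab a f := by
  have hmem : f ∈ {g ∈ E | lab g = lab f} := Finset.mem_filter.2 ⟨hf, rfl⟩
  have hcard : ({g ∈ E | lab g = lab f}.card : ℝ) ≠ 0 :=
    Nat.cast_ne_zero.2 (Finset.card_pos.2 ⟨f, hmem⟩).ne'
  rw [blockAverage_of_mem hf, blockAverage_of_mem hf, blockMean, blockMean, Finset.sum_sub_distrib,
    sub_div]
  simp [hcard]

lemma blockAverage_comp_injective (E : Finset α) (lab : α → L) (a : α → ℝ) {σ : L → L'}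
    (hσ : σ.Injective) : blockAverage E (fun f => σ (lab f)) a = blockAverage E lab a := by
  funext f
  simp only [blockAverage, blockMean, hσ.eq_iff]

/-- If the labels `lab'` refine `lab` and a function of `lab'` has a large correlation with the
error `a - blockAverage E lab a`, then passing to `lab'` increases the energy. -/
lemma sq_sum_sub_blockAverage_mul_le (E : Finset α) (lab' : α → L') (ρ : L' → L) (a : α → ℝ)
    (φ : L' → ℝ) :
    (∑ f ∈ E, (a f - blockAverage E (fun g => ρ (lab' g)) a f) * φ (lab' f)) ^ 2 ≤
      (∑ f ∈ E, blockAverage E lab' a f ^ 2 -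
        ∑ f ∈ E, blockAverage E (fun g => ρ (lab' g)) a f ^ 2) * ∑ f ∈ E, φ (lab' f) ^ 2 := by
  set lab := fun g => ρ (lab' g) with hlab
  set q := blockAverage E lab a with hq
  set q' := blockAverage E lab' a with hq'
  have h1 : ∑ f ∈ E, (a f - q f) * φ (lab' f) = ∑ f ∈ E, (q' f - q f) * φ (lab' f) := by
    simp only [sub_mul, Finset.sum_sub_distrib]
    rw [hq', sum_blockAverage_mul]
  have hqE : ∀ f ∈ E, q f = blockMean E lab a (ρ (lab' f)) := fun f hf => blockAverage_of_mem hf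
  have h2 : ∑ f ∈ E, q' f * q f = ∑ f ∈ E, q f ^ 2 := by
    have e1 : ∑ f ∈ E, q' f * q f = ∑ f ∈ E, q' f * blockMean E lab a (ρ (lab' f)) :=
      Finset.sum_congr rfl fun f hf => by rw [hqE f hf]
    have e2 : ∑ f ∈ E, q f ^ 2 = ∑ f ∈ E, q f * blockMean E lab a (lab f) :=
      Finset.sum_congr rfl fun f hf => by rw [sq]; nth_rw 2 [hqE f hf]
    rw [e1, e2, hq', sum_blockAverage_mul E lab' a fun l => blockMean E lab a (ρ l), hq,
      sum_blockAverage_mul E lab a]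
  have h3 : ∑ f ∈ E, (q' f - q f) ^ 2 = ∑ f ∈ E, q' f ^ 2 - ∑ f ∈ E, q f ^ 2 := by
    have : ∀ f ∈ E, (q' f - q f) ^ 2 = q' f ^ 2 - 2 * (q' f * q f) + q f ^ 2 :=
      fun f _ => by ring
    rw [Finset.sum_congr rfl this, Finset.sum_add_distrib, Finset.sum_sub_distrib,
      ← Finset.mul_sum, h2]
    ring
  rw [h1, ← h3]
  exact Finset.sum_mul_sq_le_sq_mul_sq _ _ _

/-- Independent memberships with probabilities averaged from `S` itself give `S` a probability
that depends only on the averages. -/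
lemma subsetWeight_blockAverage (E : Finset α) (lab : α → L) {S : Finset α} (hS : S ⊆ E) :
    subsetWeight E (blockAverage E lab (Set.indicator (S : Set α) 1)) S =
      Real.exp (-∑ f ∈ E, Real.binEntropy (blockAverage E lab (Set.indicator (S : Set α) 1) f)) := by
  set a : α → ℝ := Set.indicator (S : Set α) 1 with ha
  set q := blockAverage E lab a with hq
  have ha1 : ∀ f ∈ S, a f = 1 := fun f hf => Set.indicator_of_mem (Finset.mem_coe.2 hf) _
  have ha0 : ∀ f ∉ S, a f = 0 := fun f hf => Set.indicator_of_notMem (by simpa using hf) _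
  have hq1 : ∀ f ∈ S, q f ≠ 0 := by
    intro f hf h0
    have : a f = 0 := eq_zero_of_blockAverage_eq_zero
      (fun g _ => Set.indicator_nonneg (fun _ _ => zero_le_one) g) (hS hf) h0
    rw [ha1 f hf] at this
    exact one_ne_zero this
  have hq0 : ∀ f ∈ E \ S, 1 - q f ≠ 0 := by
    intro f hf h0
    obtain ⟨hfE, hfS⟩ := Finset.mem_sdiff.1 hf
    rw [hq, ← blockAverage_one_sub a hfE] at h0
    have : 1 - a f = 0 := eq_zero_of_blockAverage_eq_zero
      (fun g _ => sub_nonneg.2 (Set.indicator_le_self' (fun _ _ => zero_le_one) g)) hfE h0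
    rw [ha0 f hfS] at this
    norm_num at this
  have hpos : 0 < subsetWeight E q S := by
    refine (subsetWeight_nonneg hS (fun f _ => blockAverage_nonneg
      (fun g => Set.indicator_nonneg (fun _ _ => zero_le_one) g) f) fun f _ => blockAverage_le_one
      (fun g => Set.indicator_le_self' (fun _ _ => zero_le_one) g) f).lt_of_ne' ?_
    exact mul_ne_zero (Finset.prod_ne_zero_iff.2 hq1) (Finset.prod_ne_zero_iff.2 hq0)
  rw [← Real.exp_log hpos, subsetWeight, Real.log_mul (Finset.prod_ne_zero_iff.2 hq1)
    (Finset.prod_ne_zero_iff.2 hq0), Real.log_prod hq1, Real.log_prod hq0]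
  congr 1
  have e1 : ∑ f ∈ S, Real.log (q f) = ∑ f ∈ E, a f * Real.log (q f) := by
    rw [← Finset.sum_sdiff hS, Finset.sum_eq_zero (s := E \ S), zero_add]
    · exact Finset.sum_congr rfl fun f hf => by rw [ha1 f hf, one_mul]
    · intro f hf; rw [ha0 f (Finset.mem_sdiff.1 hf).2, zero_mul]
  have e2 : ∑ f ∈ E \ S, Real.log (1 - q f) = ∑ f ∈ E, (1 - a f) * Real.log (1 - q f) := by
    rw [← Finset.sum_sdiff hS, Finset.sum_eq_zero (s := S), add_zero]
    · exact Finset.sum_congr rfl fun f hf => by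
        rw [ha0 f (Finset.mem_sdiff.1 hf).2, sub_zero, one_mul]
    · intro f hf; rw [ha1 f hf, sub_self, zero_mul]
  have e3 : ∀ f ∈ E, q f = blockMean E lab a (lab f) := fun f hf => blockAverage_of_mem hf
  set φ : L → ℝ := fun l => Real.log (blockMean E lab a l) - Real.log (1 - blockMean E lab a l)
  have e4 : ∀ b : α → ℝ, ∑ f ∈ E, (b f * Real.log (q f) + (1 - b f) * Real.log (1 - q f)) =
      ∑ f ∈ E, b f * φ (lab f) + ∑ f ∈ E, Real.log (1 - q f) := by
    intro b
    rw [← Finset.sum_add_distrib]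
    exact Finset.sum_congr rfl fun f hf => by simp only [φ]; rw [← e3 f hf]; ring
  rw [e1, e2, ← Finset.sum_add_distrib, e4 a, ← sum_blockAverage_mul, ← hq, ← e4 q,
    ← Finset.sum_neg_distrib]
  refine Finset.sum_congr rfl fun f _ => ?_
  rw [Real.binEntropy, Real.log_inv, Real.log_inv]; ring

/-- The number of sets with given averages is at most the exponential of their entropy. -/
lemma card_le_exp_sum_binEntropy (E : Finset α) (lab : α → L) (q : α → ℝ)
    {T : Finset (Finset α)} (hT : T ⊆ E.powerset)
    (hq : ∀ S ∈ T, blockAverage E lab (Set.indicator (S : Set α) 1) = q) :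
    (T.card : ℝ) ≤ Real.exp (∑ f ∈ E, Real.binEntropy (q f)) := by
  rcases T.eq_empty_or_nonempty with rfl | ⟨S₀, hS₀⟩
  · simpa using (Real.exp_pos _).le
  have hq0 : ∀ f, 0 ≤ q f := fun f => by
    rw [← hq S₀ hS₀]
    exact blockAverage_nonneg (fun g => Set.indicator_nonneg (fun _ _ => zero_le_one) g) f
  have hq1 : ∀ f, q f ≤ 1 := fun f => by
    rw [← hq S₀ hS₀]
    exact blockAverage_le_one (fun g => Set.indicator_le_self' (fun _ _ => zero_le_one) g) f
  have hw : ∀ S ∈ T, subsetWeight E q S = Real.exp (-∑ f ∈ E, Real.binEntropy (q f)) := by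
    intro S hS
    rw [← hq S hS]
    exact subsetWeight_blockAverage E lab (Finset.mem_powerset.1 (hT hS))
  have hsum : ∑ S ∈ T, subsetWeight E q S ≤ 1 := by
    rw [← sum_subsetWeight E q]
    exact Finset.sum_le_sum_of_subset_of_nonneg hT fun S hS _ =>
      subsetWeight_nonneg (Finset.mem_powerset.1 hS) (fun f _ => hq0 f) fun f _ => hq1 f
  rw [Finset.sum_congr rfl hw, Finset.sum_const, nsmul_eq_mul, Real.exp_neg,
    ← div_eq_mul_inv, div_le_one (Real.exp_pos _)] at hsum
  exact hsum

end BlockAverage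

/-! ### Weak regularity -/

section WeakRegularity

variable {n : ℕ}

lemma two_mul_card_distinctPairs_le (n : ℕ) :
    2 * ((distinctPairs n).card : ℝ) ≤ (n : ℝ) ^ 2 := by
  rw [card_distinctPairs, Nat.cast_choose_two]
  nlinarith [(Nat.cast_nonneg n : (0 : ℝ) ≤ n)]

/-- The weak regularity lemma for weights on the pairs of distinct vertices: some partition of the
vertices into at most `4^k` parts, `k > 1/η²`, approximates the weights within `η` in the cut
norm by their averages over the blocks. -/
lemma exists_coloring_cut_le {a : Sym2 (Fin n) → ℝ} (hn : 0 < n) (h0 : ∀ f, 0 ≤ a f)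
    (h1 : ∀ f, a f ≤ 1) (hE : ∀ f ∉ distinctPairs n, a f = 0) {η : ℝ} (hη : 0 < η) {k : ℕ}
    (hk : 1 < k * η ^ 2) :
    ∃ c : Fin n → Fin (4 ^ k), ∀ S T : Finset (Fin n),
      |∑ i ∈ S, ∑ j ∈ T, (a s(i, j) - blockAverage (distinctPairs n) (Sym2.map c) a s(i, j))| ≤
        η * (n : ℝ) ^ 2 := by
  classical
  have hn' : (0 : ℝ) < n := Nat.cast_pos.2 hn
  set E := distinctPairs n with hEdef
  have key : ∀ k : ℕ, (∃ c : Fin n → Fin (4 ^ k), ∀ S T : Finset (Fin n),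
      |∑ i ∈ S, ∑ j ∈ T, (a s(i, j) - blockAverage E (Sym2.map c) a s(i, j))| ≤
        η * (n : ℝ) ^ 2) ∨ ∃ c : Fin n → Fin (4 ^ k),
      k * (η ^ 2 * (n : ℝ) ^ 2 / 2) ≤ ∑ f ∈ E, blockAverage E (Sym2.map c) a f ^ 2 := by
    intro k
    induction k with
    | zero =>
      right
      refine ⟨fun _ => 0, ?_⟩
      simpa using Finset.sum_nonneg fun f _ => sq_nonneg _
    | succ k ih =>
      rw [or_iff_not_imp_left]
      intro hno
      -- a partition into `4 ^ k` parts counts as one into `4 ^ (k + 1)` parts, some of them empty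
      have hup : ∀ c : Fin n → Fin (4 ^ k), ¬ ∀ S T : Finset (Fin n),
          |∑ i ∈ S, ∑ j ∈ T, (a s(i, j) - blockAverage E (Sym2.map c) a s(i, j))| ≤
            η * (n : ℝ) ^ 2 := by
        intro c hc
        have hle : 4 ^ k ≤ 4 ^ (k + 1) := Nat.pow_le_pow_right (by norm_num) (Nat.le_succ k)
        refine hno ⟨fun i => Fin.castLE hle (c i), ?_⟩
        have : blockAverage E (Sym2.map fun i => Fin.castLE hle (c i)) a =
            blockAverage E (Sym2.map c) a := by
          rw [← blockAverage_comp_injective E (Sym2.map c) a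
            (Sym2.map.injective (Fin.castLE_injective hle))]
          congr 1
          funext f
          rw [Sym2.map_map]
          rfl
        rw [this]
        exact hc
      obtain ⟨c, hc⟩ := ih.resolve_left fun ⟨c, hc⟩ => hup c hc
      have hreg := hup c
      push Not at hreg
      obtain ⟨S, T, hST⟩ := hreg
      -- refine the partition by the two sets that witness the failure
      have e : Fin (4 ^ k) × Bool × Bool ≃ Fin (4 ^ (k + 1)) :=
        Fintype.equivFinOfCardEq (by simp [pow_succ])
      set c' : Fin n → Fin (4 ^ (k + 1)) := fun i => e (c i, decide (i ∈ S), decide (i ∈ T))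
        with hc'
      set ρ : Sym2 (Fin (4 ^ (k + 1))) → Sym2 (Fin (4 ^ k)) := Sym2.map fun y => (e.symm y).1
        with hρ
      have hcc : Sym2.map c = fun f => ρ (Sym2.map c' f) := by
        funext f
        rw [hρ, Sym2.map_map]
        congr 1
        funext i
        simp [hc']
      -- the symmetrized indicator function of the rectangle
      set φ : Sym2 (Fin (4 ^ (k + 1))) → ℝ := Sym2.lift ⟨fun y z =>
        (if (e.symm y).2.1 ∧ (e.symm z).2.2 then 1 else 0) +
          (if (e.symm z).2.1 ∧ (e.symm y).2.2 then 1 else 0), fun y z => add_comm _ _⟩ with hφ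
      have hφ0 : ∀ f, 0 ≤ φ f := by
        intro f
        induction f using Sym2.ind with
        | _ y z => rw [hφ, Sym2.lift_mk]; positivity
      have hφ2 : ∀ f, φ f ≤ 2 := by
        intro f
        induction f using Sym2.ind with
        | _ y z => rw [hφ, Sym2.lift_mk]; simp only; split_ifs <;> norm_num
      set D : Sym2 (Fin n) → ℝ := fun f => a f - blockAverage E (Sym2.map c) a f with hD
      have hD0 : ∀ f ∉ E, D f = 0 := fun f hf => by
        simp only [hD]; rw [hE f hf, blockAverage_of_notMem hf, sub_zero]
      have hsum : ∑ i ∈ S, ∑ j ∈ T, D s(i, j) = ∑ f ∈ E, D f * φ (Sym2.map c' f) := by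
        have h := sum_sum_eq_diag_add_distinctPairs fun f => D f * φ (Sym2.map c' f)
        have hdiag : ∀ i : Fin n, D s(i, i) * φ (Sym2.map c' s(i, i)) = 0 := fun i => by
          rw [hD0 _ (by simp [hEdef, mem_distinctPairs]), zero_mul]
        have hφc : ∀ i j, φ (Sym2.map c' s(i, j)) =
            (if i ∈ S ∧ j ∈ T then 1 else 0) + (if j ∈ S ∧ i ∈ T then 1 else 0) := by
          intro i j
          simp [hφ, hc']
        have hrect : ∑ i, ∑ j, D s(i, j) * (if i ∈ S ∧ j ∈ T then 1 else 0) =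
            ∑ i ∈ S, ∑ j ∈ T, D s(i, j) := by
          have hi : ∀ i, ∑ j, D s(i, j) * (if i ∈ S ∧ j ∈ T then 1 else 0) =
              if i ∈ S then ∑ j ∈ T, D s(i, j) else 0 := by
            intro i
            split_ifs with h <;> simp [h, Finset.sum_ite_mem]
          simp only [hi, Finset.sum_ite_mem, Finset.univ_inter]
        have hrect' : ∑ i, ∑ j, D s(i, j) * (if j ∈ S ∧ i ∈ T then 1 else 0) =
            ∑ i ∈ S, ∑ j ∈ T, D s(i, j) := by
          rw [← hrect, Finset.sum_comm]
          exact Finset.sum_congr rfl fun i _ => Finset.sum_congr rfl fun j _ => by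
            rw [Sym2.eq_swap]
        simp only [hdiag] at h
        simp only [hφc, mul_add, Finset.sum_add_distrib, hrect, hrect', Finset.sum_const_zero,
          zero_add] at h ⊢
        linarith
      refine ⟨c', ?_⟩
      have hen := sq_sum_sub_blockAverage_mul_le E (Sym2.map c') ρ a φ
      rw [← hcc] at hen
      have hD' : ∑ f ∈ E, (a f - blockAverage E (Sym2.map c) a f) * φ (Sym2.map c' f) =
        ∑ i ∈ S, ∑ j ∈ T, D s(i, j) := hsum.symm
      rw [hD'] at hen
      have hφsq : ∑ f ∈ E, φ (Sym2.map c' f) ^ 2 ≤ 2 * (n : ℝ) ^ 2 := by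
        calc ∑ f ∈ E, φ (Sym2.map c' f) ^ 2 ≤ ∑ f ∈ E, (4 : ℝ) :=
              Finset.sum_le_sum fun f _ => by nlinarith [hφ0 (Sym2.map c' f), hφ2 (Sym2.map c' f)]
          _ = E.card * 4 := by simp
          _ ≤ _ := by linarith [two_mul_card_distinctPairs_le n]
      set Δ := ∑ f ∈ E, blockAverage E (Sym2.map c') a f ^ 2 -
        ∑ f ∈ E, blockAverage E (Sym2.map c) a f ^ 2 with hΔ
      have hbig : (η * (n : ℝ) ^ 2) ^ 2 ≤ (∑ i ∈ S, ∑ j ∈ T, D s(i, j)) ^ 2 := by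
        rw [← sq_abs (∑ i ∈ S, ∑ j ∈ T, D s(i, j))]
        exact pow_le_pow_left₀ (by positivity) hST.le 2
      have hφnn : 0 ≤ ∑ f ∈ E, φ (Sym2.map c' f) ^ 2 := Finset.sum_nonneg fun f _ => sq_nonneg _
      have hΔ0 : 0 ≤ Δ := by
        by_contra hneg
        have h' : (0 : ℝ) < (η * (n : ℝ) ^ 2) ^ 2 := by positivity
        nlinarith [mul_nonneg (not_le.1 hneg |>.le |> neg_nonneg.2) hφnn]
      have hfin : (η * (n : ℝ) ^ 2) ^ 2 ≤ Δ * (2 * (n : ℝ) ^ 2) :=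
        hbig.trans (hen.trans (mul_le_mul_of_nonneg_left hφsq hΔ0))
      have hfin' : η ^ 2 * (n : ℝ) ^ 2 / 2 ≤ Δ := by
        have h2 : (0 : ℝ) < 2 * (n : ℝ) ^ 2 := by positivity
        refine le_of_mul_le_mul_right ?_ h2
        calc _ = (η * (n : ℝ) ^ 2) ^ 2 := by ring
          _ ≤ _ := hfin
      push_cast
      linarith
  rcases key k with h | ⟨c, hc⟩
  · exact h
  · exfalso
    have hle : ∑ f ∈ E, blockAverage E (Sym2.map c) a f ^ 2 ≤ E.card := by
      calc ∑ f ∈ E, blockAverage E (Sym2.map c) a f ^ 2 ≤ ∑ f ∈ E, (1 : ℝ) :=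
            Finset.sum_le_sum fun f _ =>
              pow_le_one₀ (blockAverage_nonneg h0 f) (blockAverage_le_one h1 f)
        _ = E.card := by simp
    have h2 := two_mul_card_distinctPairs_le n
    have h3 : (0 : ℝ) < (n : ℝ) ^ 2 := by positivity
    nlinarith [mul_lt_mul_of_pos_right hk h3]

/-- A family of graphs, each of which has block averages of entropy at most `R` for some partition
into `M` parts, has at most `e^R` elements for each partition and each choice of the numbers of
edges between the parts. -/
lemma card_le_of_exists_coloring {M : ℕ} {R : ℝ} {T : Finset (Finset (Sym2 (Fin n)))}
    (hT : T ⊆ (distinctPairs n).powerset)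
    (h : ∀ S ∈ T, ∃ c : Fin n → Fin M, ∑ f ∈ distinctPairs n, Real.binEntropy
      (blockAverage (distinctPairs n) (Sym2.map c)
        (Set.indicator (S : Set (Sym2 (Fin n))) 1) f) ≤ R) :
    (T.card : ℝ) ≤ (M : ℝ) ^ n * ((distinctPairs n).card + 1 : ℝ) ^ (M * M) * Real.exp R := by
  classical
  set E := distinctPairs n with hE
  rcases T.eq_empty_or_nonempty with rfl | ⟨S₁, hS₁⟩
  · simp only [Finset.card_empty, Nat.cast_zero]; positivity
  have : Nonempty (Fin n → Fin M) := ⟨(h S₁ hS₁).choose⟩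
  choose! c hc using h
  have hcnt : ∀ (S : Finset (Sym2 (Fin n))) (l : Sym2 (Fin M)),
      min {f ∈ S | Sym2.map (c S) f = l}.card E.card < E.card + 1 := fun S l => by omega
  set Φ : Finset (Sym2 (Fin n)) → (Fin n → Fin M) × (Sym2 (Fin M) → Fin (E.card + 1)) :=
    fun S => (c S, fun l => ⟨_, hcnt S l⟩) with hΦ
  have hfib : ∀ y ∈ T.image Φ, (({S ∈ T | Φ S = y}.card : ℕ) : ℝ) ≤ Real.exp R := by
    intro y hy
    obtain ⟨S₀, hS₀, rfl⟩ := Finset.mem_image.1 hy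
    refine (card_le_exp_sum_binEntropy E (Sym2.map (c S₀)) (blockAverage E (Sym2.map (c S₀))
        (Set.indicator (S₀ : Set (Sym2 (Fin n))) 1))
      ((Finset.filter_subset _ _).trans hT) fun S hS => ?_).trans (Real.exp_le_exp.2 (hc S₀ hS₀))
    obtain ⟨hST, hSΦ⟩ := Finset.mem_filter.1 hS
    have hcc : c S = c S₀ := congrArg Prod.fst hSΦ
    have hnum : ∀ l, {f ∈ S | Sym2.map (c S₀) f = l}.card =
        {f ∈ S₀ | Sym2.map (c S₀) f = l}.card := by
      intro l
      have h1 := congrArg Fin.val (congrFun (congrArg Prod.snd hSΦ) l)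
      simp only [hΦ] at h1
      rw [hcc] at h1
      have h2 : ∀ R ∈ T, {f ∈ R | Sym2.map (c S₀) f = l}.card ≤ E.card := fun R hR =>
        Finset.card_le_card ((Finset.filter_subset _ _).trans (Finset.mem_powerset.1 (hT hR)))
      have := h2 S hST
      have := h2 S₀ hS₀
      omega
    have hsum : ∀ R ∈ T, ∀ l, ∑ f ∈ E with Sym2.map (c S₀) f = l,
        Set.indicator (R : Set (Sym2 (Fin n))) (1 : Sym2 (Fin n) → ℝ) f =
        ({f ∈ R | Sym2.map (c S₀) f = l}.card : ℝ) := by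
      intro R hR l
      simp only [Set.indicator_apply, Finset.mem_coe, Pi.one_apply]
      rw [Finset.sum_boole, Finset.filter_filter]
      congr 2
      ext f
      simp only [Finset.mem_filter]
      exact ⟨fun h => ⟨h.2.2, h.2.1⟩, fun h => ⟨Finset.mem_powerset.1 (hT hR) h.1, h.2, h.1⟩⟩
    funext f
    simp only [blockAverage, blockMean, hsum S hST, hsum S₀ hS₀, hnum]
  have himg : ((T.image Φ).card : ℝ) ≤ (M : ℝ) ^ n * (E.card + 1 : ℝ) ^ (M * M) := by
    have h1 := Finset.card_le_univ (T.image Φ)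
    rw [Fintype.card_prod, Fintype.card_fun, Fintype.card_fun, Fintype.card_fin, Fintype.card_fin,
      Fintype.card_fin] at h1
    have h2 : Fintype.card (Sym2 (Fin M)) ≤ M * M := by
      have := Fintype.card_le_of_surjective (fun z : Fin M × Fin M => s(z.1, z.2)) (fun f => by
        induction f using Sym2.ind with
        | _ i j => exact ⟨(i, j), rfl⟩)
      simpa using this
    have h3 := h1.trans (Nat.mul_le_mul_left _ (Nat.pow_le_pow_right (Nat.succ_pos _) h2))
    exact_mod_cast h3
  rw [Finset.card_eq_sum_card_image Φ T]
  push_cast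
  calc _ ≤ (T.image Φ).card • Real.exp R := Finset.sum_le_card_nsmul _ _ _ hfib
    _ = (T.image Φ).card * Real.exp R := nsmul_eq_mul _ _
    _ ≤ _ := mul_le_mul_of_nonneg_right himg (Real.exp_pos _).le

end WeakRegularity

/-! ### Counting graphs with many copies of `H` -/

section Counting

lemma two_mul_relEntropy {p : ℝ} (hp0 : 0 < p) (hp1 : p < 1) (x : ℝ) :
    2 * relEntropy p x = -Real.binEntropy x - x * Real.log p - (1 - x) * Real.log (1 - p) := by
  have h : ∀ y q : ℝ, q ≠ 0 → y * Real.log (y / q) = y * Real.log y - y * Real.log q := by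
    intro y q hq
    rcases eq_or_ne y 0 with rfl | hy
    · simp
    · rw [Real.log_div hy hq]; ring
  have h1 := h x p hp0.ne'
  have h2 := h (1 - x) (1 - p) (sub_pos.2 hp1).ne'
  rw [relEntropy, Real.binEntropy, Real.log_inv, Real.log_inv]
  linear_combination h1 + h2

lemma relEntropy_zero_nonneg {p : ℝ} (hp0 : 0 < p) (hp1 : p < 1) : 0 ≤ relEntropy p 0 := by
  have h := two_mul_relEntropy hp0 hp1 0
  have := Real.log_nonpos (sub_nonneg.2 hp1.le) (sub_le_self 1 hp0.le)
  simp only [Real.binEntropy_zero] at h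
  linarith

/-- For weights with mean `p` the relative entropy is a difference of entropies. -/
lemma two_mul_sum_relEntropy {α : Type*} (E : Finset α) {p : ℝ} (hp0 : 0 < p) (hp1 : p < 1)
    {w : α → ℝ} (hw : ∑ f ∈ E, w f = p * E.card) :
    2 * ∑ f ∈ E, relEntropy p (w f) =
      E.card * Real.binEntropy p - ∑ f ∈ E, Real.binEntropy (w f) := by
  rw [Finset.mul_sum, Finset.sum_congr rfl fun f _ => two_mul_relEntropy hp0 hp1 (w f)]
  simp only [Finset.sum_sub_distrib, ← Finset.sum_mul, Finset.sum_neg_distrib, hw,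
    Finset.sum_const, nsmul_eq_mul]
  rw [Real.binEntropy, Real.log_inv, Real.log_inv]
  ring

lemma sum_indicator_one {α : Type*} {E S : Finset α} (hS : S ⊆ E) :
    ∑ f ∈ E, Set.indicator (S : Set α) (1 : α → ℝ) f = S.card := by
  classical
  simp only [Set.indicator_apply, Finset.mem_coe, Pi.one_apply, Finset.sum_boole]
  rw [Finset.filter_mem_eq_inter, Finset.inter_eq_right.2 hS]

/-- An upper bound for a binomial coefficient by the entropy. -/
lemma choose_le_exp_binEntropy {N m : ℕ} :
    (N.choose m : ℝ) ≤ Real.exp (N * Real.binEntropy (m / N)) := by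
  have h := card_le_exp_sum_binEntropy (Finset.range N) (fun _ => ())
    (fun f => if f ∈ Finset.range N then (m : ℝ) / N else 0)
    (T := (Finset.range N).powersetCard m)
    (fun S hS => Finset.mem_powerset.2 (Finset.mem_powersetCard.1 hS).1) (by
      intro S hS
      obtain ⟨hSE, hSm⟩ := Finset.mem_powersetCard.1 hS
      funext f
      simp only [blockAverage, blockMean, Finset.filter_true, sum_indicator_one hSE, hSm,
        Finset.card_range])
  rw [Finset.card_powersetCard, Finset.card_range] at h
  refine h.trans_eq ?_
  rw [Finset.sum_congr rfl fun f hf => by rw [if_pos hf]]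
  simp

variable {α : Type*} [DecidableEq α]

/-- A family of sets of probability `δ` under independent memberships with total weight `m`
yields many sets with `m` elements close to the family. -/
lemma le_card_near_of_subsetWeight {E : Finset α} {a : α → ℝ}
    (h0 : ∀ f ∈ E, 0 ≤ a f) (h1 : ∀ f ∈ E, a f ≤ 1) {m d : ℕ} (hm : m ≤ E.card)
    (hE : 1 ≤ E.card) (hd : 0 < d) (hsum : ∑ f ∈ E, a f = m)
    {T : Finset (Finset α)} (hT : T ⊆ E.powerset) :
    (∑ S ∈ T, subsetWeight E a S - 9 * E.card / (d : ℝ) ^ 2) *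
        Real.exp (∑ f ∈ E, Real.binEntropy (a f) - d) ≤
      (d + 1) * (E.card : ℝ) ^ d *
        ({S' ∈ E.powersetCard m | ∃ S ∈ T, (S \ S').card ≤ d}.card : ℝ) := by
  refine (le_card_filter_of_subsetWeight h0 h1 (Nat.cast_pos.2 hd) hT).trans ?_
  have h := card_le_mul_card_near
    (T := T.filter fun S : Finset α => |(S.card : ℝ) - ∑ f ∈ E, a f| ≤ d) hm hE
    ((Finset.filter_subset _ _).trans hT) (d := d) (by
      intro S hS
      have := abs_le.1 (hsum ▸ (Finset.mem_filter.1 hS).2)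
      constructor
      · have h2 : (S.card : ℝ) ≤ m + d := by linarith
        exact_mod_cast h2
      · have h2 : (m : ℝ) ≤ S.card + d := by linarith
        exact_mod_cast h2)
  have h' : {S' ∈ E.powersetCard m |
      ∃ S ∈ T.filter fun S : Finset α => |(S.card : ℝ) - ∑ f ∈ E, a f| ≤ d, (S \ S').card ≤ d}.card ≤
      {S' ∈ E.powersetCard m | ∃ S ∈ T, (S \ S').card ≤ d}.card := by
    refine Finset.card_le_card fun S' hS' => ?_
    obtain ⟨h1, S, hS, h2⟩ := Finset.mem_filter.1 hS'
    exact Finset.mem_filter.2 ⟨h1, S, (Finset.mem_filter.1 hS).1, h2⟩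
  exact_mod_cast h.trans (Nat.mul_le_mul_left _ h')

/-- A lower bound for a binomial coefficient by the entropy, with an error in the form in which it
arises for the graphs with many copies of `H`. -/
lemma exp_binEntropy_le_choose {N m d : ℕ} (hm : m ≤ N) (hN : 1 ≤ N) (hd : 0 < d) :
    (1 - 9 * N / (d : ℝ) ^ 2) * Real.exp (N * Real.binEntropy (m / N) - d) ≤
      (d + 1) * (N : ℝ) ^ d * (N.choose m : ℝ) := by
  have hN' : (0 : ℝ) < N := Nat.cast_pos.2 hN
  have h := le_card_near_of_subsetWeight (E := Finset.range N) (a := fun _ => (m : ℝ) / N)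
    (fun _ _ => by positivity) (fun _ _ => div_le_one_of_le₀ (by exact_mod_cast hm) hN'.le)
    (m := m) (by simpa using hm) (by simpa using hN) hd
    (by rw [Finset.sum_const, Finset.card_range, nsmul_eq_mul, mul_div_cancel₀ _ hN'.ne'])
    subset_rfl
  rw [sum_subsetWeight, Finset.sum_const, Finset.card_range, nsmul_eq_mul] at h
  refine h.trans (mul_le_mul_of_nonneg_left ?_ (by positivity))
  have := Finset.card_le_card (Finset.filter_subset
    (fun S' => ∃ S ∈ (Finset.range N).powerset, (S \ S').card ≤ d)
    ((Finset.range N).powersetCard m))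
  rw [Finset.card_powersetCard, Finset.card_range] at this
  exact_mod_cast this

variable {V : Type*} [Fintype V] [DecidableEq V] (H : SimpleGraph V) [Fintype H.edgeSet]
  {n m : ℕ}

lemma edgeDensity_mul_card (hn : 2 ≤ n) :
    edgeDensity n m * (distinctPairs n).card = m := by
  rw [card_distinctPairs, edgeDensity, div_mul_cancel₀]
  exact Nat.cast_ne_zero.2 (Nat.choose_pos hn).ne'

lemma mem_denseEdgeSets {t : ℝ} {S : Finset (Sym2 (Fin n))} :
    S ∈ denseEdgeSets H n m t ↔ (S ⊆ distinctPairs n ∧ S.card = m) ∧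
      t ≤ pairDensity H (Set.indicator (S : Set (Sym2 (Fin n))) 1) := by
  classical
  rw [denseEdgeSets, Finset.mem_filter, Finset.mem_powersetCard]

/-- A graph with many copies of `H` is close to a feasible point of the variational problem: the
block averages of the graph over a weakly regular partition. -/
lemma exists_coloring_feasible (hn : 0 < n) {η t t' : ℝ} (hη : 0 < η) {k : ℕ}
    (hk : 1 < k * η ^ 2) (ht : t' * edgeDensity n m ^ H.edgeFinset.card ≤
      t - H.edgeFinset.card * η) {S : Finset (Sym2 (Fin n))} (hS : S ∈ denseEdgeSets H n m t) :
    ∃ c : Fin n → Fin (4 ^ k), ∃ A ∈ feasibleGraphs H n m t',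
      A.pairWeight = blockAverage (distinctPairs n) (Sym2.map c)
        (Set.indicator (S : Set (Sym2 (Fin n))) 1) := by
  have : NeZero n := ⟨hn.ne'⟩
  obtain ⟨⟨hSE, hSm⟩, hSt⟩ := (mem_denseEdgeSets H).1 hS
  set a : Sym2 (Fin n) → ℝ := Set.indicator (S : Set (Sym2 (Fin n))) 1 with ha
  have h0 : ∀ f, 0 ≤ a f := fun f => Set.indicator_nonneg (fun _ _ => zero_le_one) f
  have h1 : ∀ f, a f ≤ 1 := fun f => Set.indicator_le_self' (fun _ _ => zero_le_one) f
  obtain ⟨c, hc⟩ := exists_coloring_cut_le hn h0 h1 (fun f hf => Set.indicator_of_notMem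
    (fun hfS => hf (hSE (Finset.mem_coe.1 hfS))) _) hη hk
  set q := blockAverage (distinctPairs n) (Sym2.map c) a with hq
  have hq0 : ∀ f, 0 ≤ q f := blockAverage_nonneg h0
  have hq1 : ∀ f, q f ≤ 1 := blockAverage_le_one h1
  have hqE : ∀ f ∉ distinctPairs n, q f = 0 := fun f hf => blockAverage_of_notMem hf
  set A := EdgeWeightedGraph.ofPairWeight q hq0 hq1 hqE with hA
  have hAq : A.pairWeight = q := EdgeWeightedGraph.pairWeight_ofPairWeight q hq0 hq1 hqE
  refine ⟨c, A, ⟨?_, ?_⟩, hAq⟩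
  · rw [A.homDensity_graphon H, hAq]
    have := (abs_le.1 (abs_pairDensity_sub_le H hn h0 h1 hq0 hq1 hc)).2
    linarith
  · rw [← A.sum_pairWeight, hAq, hq, sum_blockAverage, sum_indicator_one hSE, hSm]

/-- The number of graphs with many copies of `H` is bounded by the variational problem. -/
lemma card_denseEdgeSets_le (hn : 2 ≤ n) (hp0 : 0 < edgeDensity n m)
    (hp1 : edgeDensity n m < 1) {η t t' r : ℝ} (hη : 0 < η) {k : ℕ}
    (hk : 1 < k * η ^ 2) (ht : t' * edgeDensity n m ^ H.edgeFinset.card ≤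
      t - H.edgeFinset.card * η)
    (hr : ∀ A ∈ feasibleGraphs H n m t', r ≤ A.graphon.relEntropy (edgeDensity n m)) :
    ((denseEdgeSets H n m t).card : ℝ) ≤
      ((4 ^ k : ℕ) : ℝ) ^ n * ((distinctPairs n).card + 1 : ℝ) ^ (4 ^ k * 4 ^ k) *
        Real.exp ((distinctPairs n).card * Real.binEntropy (edgeDensity n m) +
          n * relEntropy (edgeDensity n m) 0 - (n : ℝ) ^ 2 * r) := by
  have hn0 : 0 < n := by omega
  have hn' : (0 : ℝ) < n := Nat.cast_pos.2 hn0
  have : NeZero n := ⟨hn0.ne'⟩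
  refine card_le_of_exists_coloring (fun S hS => Finset.mem_powerset.2
    ((mem_denseEdgeSets H).1 hS).1.1) fun S hS => ?_
  obtain ⟨c, A, hA, hAq⟩ := exists_coloring_feasible H hn0 hη hk ht hS
  refine ⟨c, ?_⟩
  rw [← hAq]
  have h1 := hr A hA
  rw [A.relEntropy_graphon, le_div_iff₀ (by positivity)] at h1
  have h2 := two_mul_sum_relEntropy (distinctPairs n) hp0 hp1 (w := A.pairWeight) (by
    rw [A.sum_pairWeight, hA.2, edgeDensity_mul_card hn])
  linarith

/-- Each feasible point of the variational problem yields many graphs with many copies of `H`, by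
independent sampling of the edges and a change of few edges. -/
lemma le_card_denseEdgeSets (hn : 2 ≤ n) (hm : m ≤ n.choose 2) {d : ℕ} (hd : 0 < d) {t t' : ℝ}
    (ht : 0 ≤ t) {A : EdgeWeightedGraph n} (hA : A ∈ feasibleGraphs H n m t') :
    (t' * edgeDensity n m ^ H.edgeFinset.card -
        (t + H.edgeFinset.card * (2 * d / (n : ℝ) ^ 2)) -
        9 * (distinctPairs n).card / (d : ℝ) ^ 2) *
      Real.exp (∑ f ∈ distinctPairs n, Real.binEntropy (A.pairWeight f) - d) ≤
    (d + 1) * ((distinctPairs n).card : ℝ) ^ d * ((denseEdgeSets H n m t).card : ℝ) := by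
  classical
  have hn0 : 0 < n := by omega
  have : NeZero n := ⟨hn0.ne'⟩
  set E := distinctPairs n with hE
  set w := A.pairWeight with hw
  set D : Finset (Sym2 (Fin n)) → ℝ :=
    fun S => pairDensity H (Set.indicator (S : Set (Sym2 (Fin n))) 1) with hD
  set s : ℝ := t + H.edgeFinset.card * (2 * d / (n : ℝ) ^ 2) with hs
  have hs0 : 0 ≤ s := by positivity
  set T : Finset (Finset (Sym2 (Fin n))) := {S ∈ E.powerset | s ≤ D S} with hT
  have hTE : T ⊆ E.powerset := Finset.filter_subset _ _
  have hwt : ∀ S ∈ E.powerset, 0 ≤ subsetWeight E w S := fun S hS =>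
    subsetWeight_nonneg (Finset.mem_powerset.1 hS) (fun f _ => A.pairWeight_nonneg f)
      fun f _ => A.pairWeight_le_one f
  have hD1 : ∀ S, D S ≤ 1 := fun S => pairDensity_le_one H
    (fun f => Set.indicator_nonneg (fun _ _ => zero_le_one) f)
    fun f => Set.indicator_le_self' (fun _ _ => zero_le_one) f
  -- Markov's inequality for `1 - D`
  have hmass : t' * edgeDensity n m ^ H.edgeFinset.card - s ≤ ∑ S ∈ T, subsetWeight E w S := by
    have h1 : t' * edgeDensity n m ^ H.edgeFinset.card ≤ pairDensity H w := by
      rw [hw, ← A.homDensity_graphon H]; exact hA.1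
    have h2 := pairDensity_le_sum_subsetWeight H A.pairWeight_nonneg A.pairWeight_le_one
      fun f hf => A.pairWeight_eq_zero hf
    have h3 : ∑ S ∈ E.powerset, subsetWeight E w S * D S ≤
        ∑ S ∈ E.powerset, (subsetWeight E w S * s +
          if s ≤ D S then subsetWeight E w S else 0) := by
      refine Finset.sum_le_sum fun S hS => ?_
      have hS0 := hwt S hS
      split_ifs with h
      · nlinarith [hD1 S, mul_nonneg hS0 hs0, mul_le_mul_of_nonneg_left (hD1 S) hS0]
      · nlinarith [mul_le_mul_of_nonneg_left (not_le.1 h).le hS0]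
    rw [Finset.sum_add_distrib, ← Finset.sum_mul, sum_subsetWeight, one_mul,
      ← Finset.sum_filter] at h3
    have h4 := h1.trans (h2.trans h3)
    linarith
  have hsum : ∑ f ∈ E, w f = m := by rw [hw, A.sum_pairWeight, hA.2]
  have hcard : E.card = n.choose 2 := card_distinctPairs n
  have h := le_card_near_of_subsetWeight (E := E) (fun f _ => A.pairWeight_nonneg f)
    (fun f _ => A.pairWeight_le_one f) (hcard ▸ hm) (hcard ▸ Nat.choose_pos hn) hd hsum hTE
  have hsub : {S' ∈ E.powersetCard m | ∃ S ∈ T, (S \ S').card ≤ d} ⊆ denseEdgeSets H n m t := by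
    intro S' hS'
    obtain ⟨hS'E, S, hS, hSS'⟩ := Finset.mem_filter.1 hS'
    refine (mem_denseEdgeSets H).2 ⟨Finset.mem_powersetCard.1 hS'E, ?_⟩
    have h1 := (Finset.mem_filter.1 hS).2
    have h2 := pairDensity_indicator_le_of_card_sdiff_le H hn0 hSS'
    simp only [hD, hs] at h1
    linarith
  have hle : ({S' ∈ E.powersetCard m | ∃ S ∈ T, (S \ S').card ≤ d}.card : ℝ) ≤
      (denseEdgeSets H n m t).card := by exact_mod_cast Finset.card_le_card hsub
  calc _ ≤ (∑ S ∈ T, subsetWeight E w S - 9 * E.card / (d : ℝ) ^ 2) *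
        Real.exp (∑ f ∈ E, Real.binEntropy (w f) - d) :=
        mul_le_mul_of_nonneg_right (by linarith) (Real.exp_pos _).le
    _ ≤ _ := h
    _ ≤ _ := mul_le_mul_of_nonneg_left hle (by positivity)

end Counting

/-! ### Uniform bounds for the upper tail -/

section UpperTail

lemma eventually_log_le_mul_sqrt {c : ℝ} (hc : 0 < c) :
    ∀ᶠ n : ℕ in atTop, Real.log n ≤ c * √n := by
  have h := (isLittleO_log_rpow_atTop (r := 1 / 2) (by norm_num)).bound hc
  filter_upwards [tendsto_natCast_atTop_atTop.eventually h] with n hn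
  rw [Real.norm_eq_abs, Real.norm_eq_abs, ← Real.sqrt_eq_rpow,
    abs_of_nonneg (Real.sqrt_nonneg _)] at hn
  exact (le_abs_self _).trans hn

lemma eventually_one_le_log : ∀ᶠ n : ℕ in atTop, 1 ≤ Real.log n :=
  (Real.tendsto_log_atTop.comp tendsto_natCast_atTop_atTop).eventually_ge_atTop 1

lemma edgeDensity_nonneg (n m : ℕ) : 0 ≤ edgeDensity n m := by
  unfold edgeDensity; positivity

/-- The lower bound for the density in a form free of roots. -/
lemma le_edgeDensity_pow_mul_log {κ n m : ℕ} (hκ : 1 ≤ κ) {K : ℝ} (hK : 1 ≤ K)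
    (hL : 1 ≤ Real.log n)
    (h : K ≤ edgeDensity n m * Real.log n ^ (1 / (2 * (κ : ℝ)))) :
    0 < edgeDensity n m ∧ K ≤ edgeDensity n m ^ (2 * κ) * Real.log n := by
  have hκ' : (0 : ℝ) < κ := Nat.cast_pos.2 hκ
  refine ⟨(edgeDensity_nonneg n m).lt_of_ne' fun h0 => ?_, ?_⟩
  · rw [h0, zero_mul] at h; linarith
  · calc K ≤ K ^ (2 * κ) := le_self_pow₀ hK (by omega)
      _ ≤ (edgeDensity n m * Real.log n ^ (1 / (2 * (κ : ℝ)))) ^ (2 * κ) :=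
        pow_le_pow_left₀ (by linarith) h _
      _ = _ := by
        rw [mul_pow, ← Real.rpow_natCast (Real.log n ^ _), ← Real.rpow_mul (by linarith)]
        congr 1
        have : 1 / (2 * (κ : ℝ)) * ((2 * κ : ℕ) : ℝ) = 1 := by
          push_cast; field_simp
        rw [this, Real.rpow_one]

/-- The number of edges, about `n^{3/2}`, by which a sampled graph may miss its expected number of
edges: larger than the standard deviation, and small compared with `n² / log n`. -/
def edgeSlack (n : ℕ) : ℕ := n * (Nat.sqrt n + 1)

lemma edgeSlack_bounds {n : ℕ} (hn : 1 ≤ n) :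
    (n : ℝ) * √n ≤ edgeSlack n ∧ (edgeSlack n : ℝ) ≤ 2 * (n * √n) := by
  have h1 : √(n : ℝ) ≤ Nat.sqrt n + 1 := Real.real_sqrt_le_nat_sqrt_succ
  have h2 : (Nat.sqrt n : ℝ) ≤ √n := Real.nat_sqrt_le_real_sqrt
  have h3 : 1 ≤ √(n : ℝ) := Real.one_le_sqrt.2 (by exact_mod_cast hn)
  have hn0 : (0 : ℝ) ≤ n := Nat.cast_nonneg n
  unfold edgeSlack
  push_cast
  constructor
  · exact mul_le_mul_of_nonneg_left h1 hn0
  · calc (n : ℝ) * (Nat.sqrt n + 1) ≤ n * (2 * √n) := mul_le_mul_of_nonneg_left (by linarith) hn0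
      _ = _ := by ring

lemma nine_mul_card_div_edgeSlack_sq_le {n : ℕ} (hn : 1 ≤ n) :
    9 * ((distinctPairs n).card : ℝ) / (edgeSlack n : ℝ) ^ 2 ≤ 9 / (2 * n) := by
  have hn' : (0 : ℝ) < n := Nat.cast_pos.2 hn
  have h1 := (edgeSlack_bounds hn).1
  have h2 := two_mul_card_distinctPairs_le n
  have h3 : (n : ℝ) ^ 2 * n ≤ (edgeSlack n : ℝ) ^ 2 := by
    calc (n : ℝ) ^ 2 * n = (n * √n) ^ 2 := by rw [mul_pow, Real.sq_sqrt hn'.le]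
      _ ≤ _ := pow_le_pow_left₀ (by positivity) h1 2
  have h4 : (0 : ℝ) < (n : ℝ) ^ 2 * n := by positivity
  rw [div_le_div_iff₀ (h4.trans_le h3) (by positivity)]
  nlinarith

/-- The cost of sampling: `edgeSlack n` for the deviation of the likelihood, and the logarithm of
the number of ways to change `edgeSlack n` edges. -/
lemma log_edgeSlack_error_le {n : ℕ} (hn : 2 ≤ n) (hL : 1 ≤ Real.log n) :
    edgeSlack n + Real.log (edgeSlack n + 1) +
      edgeSlack n * Real.log (distinctPairs n).card ≤ 8 * (n * √n * Real.log n) := by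
  have hn' : (0 : ℝ) < n := Nat.cast_pos.2 (by omega)
  have h1 := edgeSlack_bounds (n := n) (by omega)
  have hd : (0 : ℝ) ≤ edgeSlack n := Nat.cast_nonneg _
  have h2 : Real.log (edgeSlack n + 1) ≤ edgeSlack n := by
    have := Real.log_le_sub_one_of_pos (show (0 : ℝ) < edgeSlack n + 1 by linarith)
    linarith
  have h3 : Real.log (distinctPairs n).card ≤ 2 * Real.log n := by
    have h4 := two_mul_card_distinctPairs_le n
    have h5 : (0 : ℝ) < (distinctPairs n).card := by
      rw [card_distinctPairs]; exact Nat.cast_pos.2 (Nat.choose_pos hn)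
    calc Real.log (distinctPairs n).card ≤ Real.log ((n : ℝ) ^ 2) :=
          Real.log_le_log h5 (by linarith)
      _ = _ := by rw [Real.log_pow]; norm_num
  calc _ ≤ (edgeSlack n : ℝ) + edgeSlack n + edgeSlack n * (2 * Real.log n) := by
        have := mul_le_mul_of_nonneg_left h3 hd
        linarith
    _ ≤ edgeSlack n * (4 * Real.log n) := by nlinarith
    _ ≤ (2 * (n * √n)) * (4 * Real.log n) :=
        mul_le_mul_of_nonneg_right h1.2 (by linarith)
    _ = _ := by ring

variable {V : Type*} [Fintype V] [DecidableEq V] (H : SimpleGraph V) [Fintype H.edgeSet]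
  {n m : ℕ}

lemma logUpperTail_eq (b : ℝ) (hm : m ≤ n.choose 2) :
    logUpperTail H n m b = ((1 / (n : ℝ) ^ 2 : ℝ) : EReal) * ENNReal.log (ENNReal.ofReal
      ((denseEdgeSets H n m (b * edgeDensity n m ^ H.edgeFinset.card)).card /
        ((n.choose 2).choose m : ℝ))) := by
  have hC : (0 : ℝ) < ((n.choose 2).choose m : ℝ) := Nat.cast_pos.2 (Nat.choose_pos hm)
  rw [logUpperTail, uniformGraph_graphHomDensity_ge, ENNReal.ofReal_div_of_pos hC,
    ENNReal.ofReal_natCast, ENNReal.ofReal_natCast, ENNReal.div_eq_inv_mul]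

lemma coe_eq_mul_log_exp (hn : 0 < n) (y : ℝ) :
    (y : EReal) = ((1 / (n : ℝ) ^ 2 : ℝ) : EReal) *
      ENNReal.log (ENNReal.ofReal (Real.exp ((n : ℝ) ^ 2 * y))) := by
  have hn' : (0 : ℝ) < n := Nat.cast_pos.2 hn
  rw [ENNReal.log_ofReal_of_pos (Real.exp_pos _), Real.log_exp, ← EReal.coe_mul]
  congr 1
  field_simp

lemma logUpperTail_le (hn : 0 < n) (hm : m ≤ n.choose 2) {b y : ℝ}
    (h : ((denseEdgeSets H n m (b * edgeDensity n m ^ H.edgeFinset.card)).card : ℝ) ≤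
      (n.choose 2).choose m * Real.exp ((n : ℝ) ^ 2 * y)) : logUpperTail H n m b ≤ y := by
  have hC : (0 : ℝ) < ((n.choose 2).choose m : ℝ) := Nat.cast_pos.2 (Nat.choose_pos hm)
  rw [logUpperTail_eq H b hm, coe_eq_mul_log_exp hn y]
  refine mul_le_mul_of_nonneg_left (ENNReal.log_monotone (ENNReal.ofReal_le_ofReal ?_))
    (EReal.coe_nonneg.2 (by positivity))
  rwa [div_le_iff₀' hC]

lemma le_logUpperTail (hn : 0 < n) (hm : m ≤ n.choose 2) {b y : ℝ}
    (h : (n.choose 2).choose m * Real.exp ((n : ℝ) ^ 2 * y) ≤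
      ((denseEdgeSets H n m (b * edgeDensity n m ^ H.edgeFinset.card)).card : ℝ)) :
    (y : EReal) ≤ logUpperTail H n m b := by
  have hC : (0 : ℝ) < ((n.choose 2).choose m : ℝ) := Nat.cast_pos.2 (Nat.choose_pos hm)
  rw [logUpperTail_eq H b hm, coe_eq_mul_log_exp hn y]
  refine mul_le_mul_of_nonneg_left (ENNReal.log_monotone (ENNReal.ofReal_le_ofReal ?_))
    (EReal.coe_nonneg.2 (by positivity))
  rwa [le_div_iff₀' hC]

lemma logUpperTail_eq_bot (hn : 0 < n) (hm : m ≤ n.choose 2) {b : ℝ}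
    (h : denseEdgeSets H n m (b * edgeDensity n m ^ H.edgeFinset.card) = ∅) :
    logUpperTail H n m b = ⊥ := by
  rw [logUpperTail_eq H b hm, h]
  simp only [Finset.card_empty, Nat.cast_zero, zero_div, ENNReal.ofReal_zero, ENNReal.log_zero]
  exact EReal.coe_mul_bot_of_pos (by positivity)

/-- A bound above `1` on the density cannot be attained, so a density `p` for which it can is
less than `1`. -/
lemma edgeDensity_lt_one_of_le {κ : ℕ} {b : ℝ} (hb : 1 < b)
    (h : b * edgeDensity n m ^ κ ≤ 1) : edgeDensity n m < 1 := by
  by_contra hp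
  have := one_le_pow₀ (not_lt.1 hp) (n := κ)
  nlinarith

lemma relEntropy_edgeDensity_zero_le (hn : 2 ≤ n) (hp0 : 0 < edgeDensity n m)
    (hp1 : edgeDensity n m < 1) : relEntropy (edgeDensity n m) 0 ≤ Real.log n := by
  have hn' : (0 : ℝ) < n := Nat.cast_pos.2 (by omega)
  have hN : (0 : ℝ) < n.choose 2 := Nat.cast_pos.2 (Nat.choose_pos hn)
  have hmN : (m : ℝ) + 1 ≤ n.choose 2 := by
    rw [edgeDensity, div_lt_one hN] at hp1
    exact_mod_cast hp1
  have h1 : ((n : ℝ) ^ 2)⁻¹ ≤ 1 - edgeDensity n m := by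
    have h2 : ((n : ℝ) ^ 2)⁻¹ ≤ ((n.choose 2 : ℝ))⁻¹ := by
      have := two_mul_card_distinctPairs_le n
      rw [card_distinctPairs] at this
      exact inv_anti₀ hN (by linarith)
    refine h2.trans ?_
    rw [edgeDensity, le_sub_iff_add_le, inv_eq_one_div, ← add_div, div_le_one hN]
    linarith
  have h3 := Real.log_le_log (by positivity) h1
  rw [Real.log_inv, Real.log_pow] at h3
  have h4 := two_mul_relEntropy hp0 hp1 0
  simp only [Real.binEntropy_zero] at h4
  push_cast at h3
  linarith

/-- Up to a factor `exp (O(n^{3/2} log n))` there are at least as many graphs with `m` edges as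
the entropy says. -/
lemma exp_binEntropy_edgeDensity_le (hn : 9 ≤ n) (hL : 1 ≤ Real.log n) (hm : m ≤ n.choose 2) :
    Real.exp ((n.choose 2 : ℕ) * Real.binEntropy (edgeDensity n m)) ≤
      Real.exp (1 + 8 * (n * √n * Real.log n)) * ((n.choose 2).choose m : ℝ) := by
  have hn' : (9 : ℝ) ≤ n := by exact_mod_cast hn
  have hNpos : 1 ≤ n.choose 2 := Nat.choose_pos (by omega)
  have hN1 : (1 : ℝ) ≤ (n.choose 2 : ℕ) := Nat.one_le_cast.2 hNpos
  have hC := exp_binEntropy_le_choose hm hNpos (d := edgeSlack n) (by rw [edgeSlack]; positivity)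
  have h9 := nine_mul_card_div_edgeSlack_sq_le (n := n) (by omega)
  have herr := log_edgeSlack_error_le (n := n) (by omega) hL
  rw [card_distinctPairs] at h9 herr
  change (1 - 9 * _ / _) * Real.exp (_ * Real.binEntropy (edgeDensity n m) - _) ≤ _ at hC
  generalize ((n.choose 2 : ℕ) : ℝ) = N at *
  generalize (((n.choose 2).choose m : ℕ) : ℝ) = C at *
  generalize edgeDensity n m = p at *
  have hd0 : (0 : ℝ) ≤ edgeSlack n := Nat.cast_nonneg _
  generalize edgeSlack n = d at *
  have hhalf : (1 : ℝ) / 2 ≤ 1 - 9 * N / (d : ℝ) ^ 2 := by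
    have : (9 : ℝ) / (2 * n) ≤ 1 / 2 := by
      rw [div_le_div_iff₀ (by linarith) (by norm_num)]; linarith
    linarith
  have h1 : 1 / 2 * Real.exp (N * Real.binEntropy p - d) ≤ (d + 1) * N ^ d * C :=
    (mul_le_mul_of_nonneg_right hhalf (Real.exp_pos _).le).trans hC
  have hfac : 0 < (d + 1) * N ^ d := by positivity
  have hC0 : 0 ≤ C := by
    have h2 := (mul_pos (by norm_num : (0 : ℝ) < 1 / 2) (Real.exp_pos _)).le.trans h1
    exact nonneg_of_mul_nonneg_right h2 hfac
  have h2 : (2 : ℝ) ≤ Real.exp 1 := by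
    have := Real.add_one_le_exp (1 : ℝ); linarith
  have h3 : Real.exp (Real.log (d + 1) + d * Real.log N) = (d + 1) * N ^ d := by
    rw [Real.exp_add, Real.exp_log (by linarith), mul_comm (d : ℝ), Real.exp_mul,
      Real.exp_log (by linarith), Real.rpow_natCast]
  calc Real.exp (N * Real.binEntropy p)
      = Real.exp d * Real.exp (N * Real.binEntropy p - d) := by
        rw [← Real.exp_add]; congr 1; ring
    _ ≤ Real.exp d * (2 * ((d + 1) * N ^ d * C)) :=
        mul_le_mul_of_nonneg_left (by linarith) (Real.exp_pos _).le
    _ = 2 * (Real.exp d * Real.exp (Real.log (d + 1) + d * Real.log N)) * C := by rw [h3]; ring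
    _ = 2 * Real.exp (d + Real.log (d + 1) + d * Real.log N) * C := by
        rw [← Real.exp_add, add_assoc]
    _ ≤ Real.exp 1 * Real.exp (8 * (n * √n * Real.log n)) * C := by gcongr
    _ = _ := by rw [← Real.exp_add]

/-- The number of classes of graphs is `exp (O(n^{3/2} log n))` if the partitions have at most
about `n^{1/4}` parts. -/
lemma card_classes_le {M : ℕ} (hn : 9 ≤ n) (hL : 1 ≤ Real.log n) (hM1 : 1 ≤ M)
    (hM : ((M * M : ℕ) : ℝ) ≤ 27 * √n) :
    (M : ℝ) ^ n * ((n.choose 2 : ℕ) + 1 : ℝ) ^ (M * M) ≤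
      Real.exp (56 * (n * √n * Real.log n)) := by
  have hn' : (9 : ℝ) ≤ n := by exact_mod_cast hn
  have hM1' : (1 : ℝ) ≤ M := Nat.one_le_cast.2 hM1
  have hxx : √(n : ℝ) * √n = n := Real.mul_self_sqrt (by linarith)
  have hx3 : 3 ≤ √(n : ℝ) := Real.le_sqrt_of_sq_le (by linarith)
  have h2N := two_mul_card_distinctPairs_le n
  rw [card_distinctPairs] at h2N
  have hN0 : (0 : ℝ) ≤ (n.choose 2 : ℕ) := Nat.cast_nonneg _
  generalize ((n.choose 2 : ℕ) : ℝ) = N at *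
  have hsq : Real.log ((n : ℝ) ^ 2) = 2 * Real.log n := by rw [Real.log_pow]; norm_num
  have h1 : Real.log M ≤ 2 * Real.log n := by
    rw [← hsq]
    refine Real.log_le_log (by linarith) ?_
    push_cast at hM
    nlinarith
  have h2 : Real.log (N + 1) ≤ 2 * Real.log n := by
    rw [← hsq]
    exact Real.log_le_log (by linarith) (by nlinarith)
  have e1 : (M : ℝ) ^ n = Real.exp (n * Real.log M) := by
    rw [Real.exp_nat_mul, Real.exp_log (by linarith)]
  have e2 : (N + 1) ^ (M * M) = Real.exp (((M * M : ℕ) : ℝ) * Real.log (N + 1)) := by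
    rw [Real.exp_nat_mul, Real.exp_log (by linarith)]
  rw [e1, e2, ← Real.exp_add, Real.exp_le_exp]
  have h3 : (n : ℝ) * Real.log M ≤ n * (2 * Real.log n) :=
    mul_le_mul_of_nonneg_left h1 (by linarith)
  have h4 : ((M * M : ℕ) : ℝ) * Real.log (N + 1) ≤ (27 * √n) * (2 * Real.log n) :=
    mul_le_mul hM h2 (Real.log_nonneg (by linarith)) (by linarith)
  have h5 : (n : ℝ) * Real.log n ≤ n * √n * Real.log n := by
    rw [mul_right_comm]
    exact le_mul_of_one_le_right (by nlinarith) (by linarith)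
  have h6 : √(n : ℝ) * Real.log n ≤ n * √n * Real.log n := by
    rw [mul_assoc]
    exact le_mul_of_one_le_left (by nlinarith) (by linarith)
  linarith

lemma four_pow_mul_four_pow_le {k : ℕ} (hn : 1 ≤ n) (hk : 3 * (k : ℝ) ≤ Real.log n / 2 + 3) :
    ((4 ^ k * 4 ^ k : ℕ) : ℝ) ≤ 27 * √n := by
  have hn' : (1 : ℝ) ≤ n := by exact_mod_cast hn
  have h2 : ((4 ^ k * 4 ^ k : ℕ) : ℝ) = Real.exp (k * Real.log 16) := by
    rw [Real.exp_nat_mul, Real.exp_log (by norm_num), ← mul_pow]; push_cast; norm_num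
  have h3 : Real.log 16 ≤ 3 := by
    have h4 : Real.log 16 = 4 * Real.log 2 := by
      rw [show (16 : ℝ) = 2 ^ 4 by norm_num, Real.log_pow]; norm_num
    have := Real.log_two_lt_d9
    linarith
  have h5 : (k : ℝ) * Real.log 16 ≤ Real.log n / 2 + 3 := by
    have := mul_le_mul_of_nonneg_left h3 (Nat.cast_nonneg (α := ℝ) k)
    linarith
  have h6 : Real.exp (Real.log n / 2) = √n := by
    rw [Real.sqrt_eq_rpow, Real.rpow_def_of_pos (by linarith)]; congr 1; ring
  have h7 : Real.exp 3 ≤ 27 := by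
    have h8 : Real.exp 3 = Real.exp 1 ^ 3 := by rw [← Real.exp_nat_mul]; norm_num
    rw [h8]
    calc Real.exp 1 ^ 3 ≤ 3 ^ 3 := pow_le_pow_left₀ (Real.exp_pos _).le
          (Real.exp_one_lt_d9.le.trans (by norm_num)) 3
      _ = 27 := by norm_num
  rw [h2]
  calc Real.exp (k * Real.log 16) ≤ Real.exp (Real.log n / 2 + 3) := Real.exp_le_exp.2 h5
    _ = √n * Real.exp 3 := by rw [Real.exp_add, h6]
    _ ≤ √n * 27 := mul_le_mul_of_nonneg_left h7 (Real.sqrt_nonneg _)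
    _ = 27 * √n := by ring

/-- The upper bound, at a single `n` that is large in the sense of the hypotheses. -/
lemma card_denseEdgeSets_le_choose_mul_exp (hκ0 : 1 ≤ H.edgeFinset.card) {ε b r : ℝ}
    (hε : 0 < ε) (hn : 9 ≤ n) (hL : 1 ≤ Real.log n) (hLs : Real.log n ≤ ε / 67 * √n)
    (hm : m ≤ n.choose 2) (hp0 : 0 < edgeDensity n m) (hp1 : edgeDensity n m < 1)
    (hK : 6 * (H.edgeFinset.card : ℝ) ^ 2 / ε ^ 2 ≤
      edgeDensity n m ^ (2 * H.edgeFinset.card) * Real.log n)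
    (hr : ∀ A ∈ feasibleGraphs H n m (b - ε), r ≤ A.graphon.relEntropy (edgeDensity n m)) :
    ((denseEdgeSets H n m (b * edgeDensity n m ^ H.edgeFinset.card)).card : ℝ) ≤
      (n.choose 2).choose m * Real.exp ((n : ℝ) ^ 2 * (-r + ε)) := by
  set κ := H.edgeFinset.card with hκ
  set p := edgeDensity n m with hp
  set L := Real.log n with hLdef
  set x := √(n : ℝ) with hx
  have hκ' : (0 : ℝ) < κ := Nat.cast_pos.2 hκ0
  have hn' : (9 : ℝ) ≤ n := by exact_mod_cast hn
  have hxx : x * x = n := Real.mul_self_sqrt (by linarith)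
  have hx1 : 1 ≤ x := Real.one_le_sqrt.2 (by linarith)
  have hpκ : 0 < p ^ κ := pow_pos hp0 κ
  -- the accuracy in the cut norm that changes densities of `H` by at most `ε p ^ κ`
  set η := ε * p ^ κ / κ with hη
  have hη0 : 0 < η := by positivity
  set k := ⌊1 / η ^ 2⌋₊ + 1 with hk
  have hk1 : 1 < k * η ^ 2 := by
    have := Nat.lt_floor_add_one (1 / η ^ 2)
    rw [div_lt_iff₀ (by positivity)] at this
    rw [hk]; push_cast; exact this
  have hk2 : (k : ℝ) ≤ 1 / η ^ 2 + 1 := by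
    have := Nat.floor_le (show 0 ≤ 1 / η ^ 2 by positivity)
    rw [hk]; push_cast; linarith
  have hk3 : 3 * (k : ℝ) ≤ L / 2 + 3 := by
    have h1 : 1 / η ^ 2 ≤ L / 6 := by
      rw [hη, div_le_div_iff₀ (by positivity) (by norm_num), div_pow, mul_pow, ← pow_mul,
        mul_comm κ 2]
      rw [div_le_iff₀ (by positivity)] at hK
      rw [mul_div_assoc', le_div_iff₀ (by positivity)]
      linarith
    linarith
  have hup := card_denseEdgeSets_le H (t := b * p ^ κ) (t' := b - ε) (r := r) (by omega) hp0 hp1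
    hη0 hk1 (by rw [← hκ, ← hp, hη, mul_div_cancel₀ _ hκ'.ne']; linarith) hr
  have hcls := card_classes_le hn hL (Nat.one_le_pow k 4 (by norm_num))
    (four_pow_mul_four_pow_le (k := k) (by omega) hk3)
  have hent := exp_binEntropy_edgeDensity_le hn hL hm
  have hI := relEntropy_edgeDensity_zero_le (m := m) (by omega : 2 ≤ n) hp0 hp1
  rw [card_distinctPairs] at hup
  rw [← hp] at hup hent hI
  rw [← hx, ← hLdef] at hcls hent
  have hfinal : 56 * (n * x * L) + n * relEntropy p 0 + (1 + 8 * (n * x * L)) ≤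
      (n : ℝ) ^ 2 * ε := by
    have e1 : n * relEntropy p 0 ≤ n * L := mul_le_mul_of_nonneg_left hI (by linarith)
    have e2 : (n : ℝ) * L ≤ n * x * L := by
      rw [mul_right_comm]
      exact le_mul_of_one_le_right (by nlinarith) hx1
    have e4 : 1 ≤ n * x * L := by nlinarith
    have e5 : 67 * (n * x * L) ≤ (n : ℝ) ^ 2 * ε := by
      have := mul_le_mul_of_nonneg_left hLs (show 0 ≤ 67 * (n * x) by nlinarith)
      calc 67 * (n * x * L) = 67 * (n * x) * L := by ring
        _ ≤ 67 * (n * x) * (ε / 67 * x) := this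
        _ = n * (x * x) * ε := by ring
        _ = _ := by rw [hxx]; ring
    linarith
  refine hup.trans ?_
  have hC0 : (0 : ℝ) ≤ ((n.choose 2).choose m : ℕ) := Nat.cast_nonneg _
  generalize (((n.choose 2).choose m : ℕ) : ℝ) = C at *
  generalize ((n.choose 2 : ℕ) : ℝ) = N at *
  generalize ((4 ^ k : ℕ) : ℝ) ^ n * (N + 1) ^ (4 ^ k * 4 ^ k) = Q at *
  calc Q * Real.exp (N * Real.binEntropy p + n * relEntropy p 0 - (n : ℝ) ^ 2 * r)
      = Q * (Real.exp (N * Real.binEntropy p) *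
        Real.exp (n * relEntropy p 0 - (n : ℝ) ^ 2 * r)) := by
        rw [← Real.exp_add]; congr 2; ring
    _ ≤ Real.exp (56 * (n * x * L)) * ((Real.exp (1 + 8 * (n * x * L)) * C) *
          Real.exp (n * relEntropy p 0 - (n : ℝ) ^ 2 * r)) :=
        mul_le_mul hcls (mul_le_mul_of_nonneg_right hent (Real.exp_pos _).le)
          (by positivity) (Real.exp_pos _).le
    _ = C * Real.exp (56 * (n * x * L) + (1 + 8 * (n * x * L)) +
          (n * relEntropy p 0 - (n : ℝ) ^ 2 * r)) := by
        rw [Real.exp_add (_ + _) (_ - _), Real.exp_add (56 * _)]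
        ring
    _ ≤ _ := by
        refine mul_le_mul_of_nonneg_left (Real.exp_le_exp.2 ?_) hC0
        linarith

/-- The lower bound, at a single `n` that is large in the sense of the hypotheses. -/
lemma choose_mul_exp_le_card_denseEdgeSets {ε b : ℝ}
    (hε : 0 < ε) (hb : 0 ≤ b) (hn : 2 ≤ n) (hL : 1 ≤ Real.log n)
    (hLs : Real.log n ≤ ε / 9 * √n)
    (hLs' : Real.log n ≤ ε / (4 * H.edgeFinset.card + 6) * √n)
    (hm : m ≤ n.choose 2) (hp0 : 0 < edgeDensity n m) (hp1 : edgeDensity n m < 1)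
    (hK : 1 ≤ edgeDensity n m ^ (2 * H.edgeFinset.card) * Real.log n)
    {A : EdgeWeightedGraph n} (hA : A ∈ feasibleGraphs H n m (b + ε)) :
    (n.choose 2).choose m *
        Real.exp ((n : ℝ) ^ 2 * (-(A.graphon.relEntropy (edgeDensity n m)) - ε)) ≤
      ((denseEdgeSets H n m (b * edgeDensity n m ^ H.edgeFinset.card)).card : ℝ) := by
  have hn0 : 0 < n := by omega
  have : NeZero n := ⟨hn0.ne'⟩
  set κ := H.edgeFinset.card with hκ
  set p := edgeDensity n m with hp
  set L := Real.log n with hLdef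
  set d := edgeSlack n with hd
  set x := √(n : ℝ) with hx
  have hn' : (2 : ℝ) ≤ n := by exact_mod_cast hn
  have hxx : x * x = n := Real.mul_self_sqrt (by linarith)
  have hx1 : 1 ≤ x := Real.one_le_sqrt.2 (by linarith)
  have hnx : 1 ≤ n * x := one_le_mul_of_one_le_of_one_le (by linarith) hx1
  have hpκ : 0 < p ^ κ := pow_pos hp0 κ
  have hpκ1 : p ^ κ ≤ 1 := pow_le_one₀ hp0.le hp1.le
  have hlow := le_card_denseEdgeSets H hn hm (d := d) (by rw [hd, edgeSlack]; positivity)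
    (t := b * p ^ κ) (by positivity) hA
  have hC := choose_le_exp_binEntropy (N := n.choose 2) (m := m)
  have hpN : (m : ℝ) / (n.choose 2 : ℕ) = p := rfl
  rw [hpN] at hC
  have hcard : (distinctPairs n).card = n.choose 2 := card_distinctPairs n
  have h9 := nine_mul_card_div_edgeSlack_sq_le (n := n) (by omega)
  have herr := log_edgeSlack_error_le hn hL
  have hI := A.relEntropy_graphon p
  rw [eq_div_iff (by positivity)] at hI
  have hI0 := relEntropy_zero_nonneg hp0 hp1
  have hent := two_mul_sum_relEntropy (distinctPairs n) hp0 hp1 (w := A.pairWeight) (by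
    rw [A.sum_pairWeight, hA.2, edgeDensity_mul_card hn])
  rw [hcard] at hlow h9 herr hent
  have hNpos : 1 ≤ n.choose 2 := Nat.choose_pos hn
  set N : ℝ := ((n.choose 2 : ℕ) : ℝ) with hN
  have hN1 : 1 ≤ N := Nat.one_le_cast.2 hNpos
  set C : ℝ := (((n.choose 2).choose m : ℕ) : ℝ) with hCdef
  set entA := ∑ f ∈ distinctPairs n, Real.binEntropy (A.pairWeight f) with hent₀
  have hd0 : (0 : ℝ) ≤ d := Nat.cast_nonneg d
  clear_value N C entA
  -- the sampled graph has enough copies of `H` with probability at least `1 / n`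
  have hprob : 1 / n ≤ (b + ε) * p ^ κ - (b * p ^ κ + κ * (2 * d / (n : ℝ) ^ 2)) -
      9 * N / (d : ℝ) ^ 2 := by
    have e1 : 2 * (d : ℝ) / (n : ℝ) ^ 2 ≤ 4 / x := by
      rw [div_le_div_iff₀ (by positivity) (by linarith)]
      have := (edgeSlack_bounds (n := n) (by omega)).2
      calc 2 * (d : ℝ) * x ≤ 2 * (2 * (n * x)) * x := by nlinarith
        _ = 4 * n * (x * x) := by ring
        _ = 4 * (n : ℝ) ^ 2 := by rw [hxx]; ring
    have e2 : (1 : ℝ) / n ≤ 1 / x := one_div_le_one_div_of_le (by linarith)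
      (hxx ▸ le_mul_of_one_le_left (by linarith) hx1)
    have e3 : (4 * κ + 6) / x ≤ ε * p ^ κ := by
      have h1 : 1 ≤ p ^ κ * L := by
        calc 1 ≤ p ^ (2 * κ) * L := hK
          _ = p ^ κ * (p ^ κ * L) := by rw [two_mul, pow_add]; ring
          _ ≤ 1 * (p ^ κ * L) := mul_le_mul_of_nonneg_right hpκ1 (by positivity)
          _ = _ := one_mul _
      rw [div_le_iff₀ (by linarith)]
      have h2 : L * (4 * κ + 6) ≤ ε * x := by
        rw [div_mul_eq_mul_div, le_div_iff₀ (by positivity)] at hLs'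
        exact hLs'
      calc (4 * (κ : ℝ) + 6) ≤ (4 * κ + 6) * (p ^ κ * L) :=
            le_mul_of_one_le_right (by positivity) h1
        _ = p ^ κ * (L * (4 * κ + 6)) := by ring
        _ ≤ p ^ κ * (ε * x) := mul_le_mul_of_nonneg_left h2 hpκ.le
        _ = _ := by ring
    have e4 : (κ : ℝ) * (2 * d / (n : ℝ) ^ 2) ≤ κ * (4 / x) :=
      mul_le_mul_of_nonneg_left e1 (Nat.cast_nonneg κ)
    have e5 : (9 : ℝ) / (2 * n) = 9 / 2 * (1 / n) := by field_simp
    have e6 : (4 * (κ : ℝ) + 6) / x = κ * (4 / x) + 6 * (1 / x) := by ring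
    have e7 : (0 : ℝ) ≤ 1 / x := by positivity
    rw [e5] at h9
    linarith
  have hlow' : 1 / n * Real.exp (entA - d) ≤ (d + 1) * N ^ d *
      ((denseEdgeSets H n m (b * p ^ κ)).card : ℝ) :=
    (mul_le_mul_of_nonneg_right hprob (Real.exp_pos _).le).trans hlow
  have hfac : (0 : ℝ) < (d + 1) * N ^ d := by positivity
  have hexp : Real.exp (Real.log (d + 1) + d * Real.log N) = (d + 1) * N ^ d := by
    rw [Real.exp_add, Real.exp_log (by linarith), mul_comm (d : ℝ), Real.exp_mul,
      Real.exp_log (by linarith), Real.rpow_natCast]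
  have hfinal : L + d + Real.log (d + 1) + d * Real.log N ≤ (n : ℝ) ^ 2 * ε := by
    have e3 : L ≤ n * x * L := le_mul_of_one_le_left (by linarith) hnx
    have e5 : 9 * (n * x * L) ≤ (n : ℝ) ^ 2 * ε := by
      have := mul_le_mul_of_nonneg_left hLs (show 0 ≤ 9 * (n * x) by linarith)
      calc 9 * (n * x * L) = 9 * (n * x) * L := by ring
        _ ≤ 9 * (n * x) * (ε / 9 * x) := this
        _ = n * (x * x) * ε := by ring
        _ = _ := by rw [hxx]; ring
    linarith
  refine le_of_mul_le_mul_left (le_trans ?_ hlow') hfac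
  have h1n : (1 : ℝ) / n = Real.exp (-L) := by
    rw [Real.exp_neg, hLdef, Real.exp_log (by linarith), one_div]
  rw [← hexp, h1n]
  calc _ ≤ Real.exp (Real.log (d + 1) + d * Real.log N) * (Real.exp (N * Real.binEntropy p) *
        Real.exp ((n : ℝ) ^ 2 * (-(A.graphon.relEntropy p) - ε))) := by gcongr
    _ = Real.exp (Real.log (d + 1) + d * Real.log N + (N * Real.binEntropy p +
        (n : ℝ) ^ 2 * (-(A.graphon.relEntropy p) - ε))) := by
        rw [Real.exp_add (Real.log _ + _), Real.exp_add (N * _)]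
    _ ≤ Real.exp (-L + (entA - d)) := by
        rw [Real.exp_le_exp]
        have : 0 ≤ n * relEntropy p 0 := mul_nonneg (by linarith) hI0
        have e : (n : ℝ) ^ 2 * (-(A.graphon.relEntropy p) - ε) =
            -(A.graphon.relEntropy p * (n : ℝ) ^ 2) - (n : ℝ) ^ 2 * ε := by ring
        rw [e, hI, hent]
        linarith
    _ = _ := Real.exp_add _ _

end UpperTail

/-! ### The large deviation estimate and its limiting form -/

section LargeDeviations

variable {V : Type*} [Fintype V] [DecidableEq V] (H : SimpleGraph V) [Fintype H.edgeSet]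

lemma denseEdgeSets_eq_empty {n m : ℕ} {t : ℝ} (ht : 1 < t) : denseEdgeSets H n m t = ∅ := by
  refine Finset.eq_empty_of_forall_notMem fun S hS => ?_
  have h1 := ((mem_denseEdgeSets H).1 hS).2
  have h2 := pairDensity_le_one H
    (w := Set.indicator (S : Set (Sym2 (Fin n))) (1 : Sym2 (Fin n) → ℝ))
    (fun f => Set.indicator_nonneg (fun _ _ => zero_le_one) f)
    fun f => Set.indicator_le_self' (fun _ _ => zero_le_one) f
  linarith

/-- The two-sided estimate, with a constant `K` and a threshold for `n` that depend only on `H`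
and `ε`. -/
lemma exists_forall_logUpperTail_bounds (hκ0 : 1 ≤ H.edgeFinset.card) {b : ℝ} (hb : 1 < b)
    {ε : ℝ} (hε : 0 < ε) :
    ∃ K : ℝ, ∀ᶠ n : ℕ in atTop, ∀ m : ℕ, m ≤ n.choose 2 →
      K ≤ edgeDensity n m * Real.log n ^ (1 / (2 * (H.edgeFinset.card : ℝ))) →
        -psiHat H n m (b + ε) - (ε : EReal) ≤ logUpperTail H n m b ∧
        logUpperTail H n m b ≤ -psiHat H n m (b - ε) + (ε : EReal) := by
  set κ := H.edgeFinset.card with hκ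
  refine ⟨max 1 (6 * (κ : ℝ) ^ 2 / ε ^ 2), ?_⟩
  filter_upwards [eventually_ge_atTop 9, eventually_one_le_log,
    eventually_log_le_mul_sqrt (c := ε / 67) (by positivity),
    eventually_log_le_mul_sqrt (c := ε / 9) (by positivity),
    eventually_log_le_mul_sqrt (c := ε / (4 * κ + 6)) (by positivity)]
    with n hn hL hL1 hL2 hL3 m hm hK
  have : NeZero n := ⟨by omega⟩
  obtain ⟨hp0, hK'⟩ := le_edgeDensity_pow_mul_log hκ0 (le_max_left _ _) hL hK
  constructor
  · rw [EReal.sub_le_iff_le_add (Or.inl (EReal.coe_ne_bot ε)) (Or.inl (EReal.coe_ne_top ε)),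
      EReal.neg_le]
    refine le_iInf₂ fun A hA => ?_
    rw [EReal.neg_le, ← EReal.sub_le_iff_le_add (Or.inl (EReal.coe_ne_bot ε))
      (Or.inl (EReal.coe_ne_top ε)), ← EReal.coe_neg, ← EReal.coe_sub]
    -- a feasible point has density at most `1`, which keeps `p` away from `1`
    have hp1 : edgeDensity n m < 1 := by
      refine edgeDensity_lt_one_of_le (κ := κ) (show 1 < b + ε by linarith) (hA.1.trans ?_)
      rw [A.homDensity_graphon H]
      exact pairDensity_le_one H A.pairWeight_nonneg A.pairWeight_le_one
    exact le_logUpperTail H (by omega) hm (choose_mul_exp_le_card_denseEdgeSets H hε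
      (by linarith) (by omega) hL hL2 hL3 hm hp0 hp1 ((le_max_left _ _).trans hK') hA)
  · by_cases hbp : 1 < b * edgeDensity n m ^ κ
    · rw [logUpperTail_eq_bot H (by omega) hm (denseEdgeSets_eq_empty H hbp)]
      exact bot_le
    have hp1 := edgeDensity_lt_one_of_le hb (not_lt.1 hbp)
    have key : ∀ r : ℝ, (r : EReal) ≤ psiHat H n m (b - ε) →
        logUpperTail H n m b ≤ ((-r + ε : ℝ) : EReal) := fun r hr =>
      logUpperTail_le H (by omega) hm (card_denseEdgeSets_le_choose_mul_exp H hκ0 hε hn hL hL1 hm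
        hp0 hp1 ((le_max_right _ _).trans hK') fun A hA =>
          EReal.coe_le_coe_iff.1 (hr.trans (iInf₂_le A hA)))
    induction hψ : psiHat H n m (b - ε) with
    | bot => rw [EReal.neg_bot, EReal.top_add_coe]; exact le_top
    | coe r =>
      have := key r hψ.ge
      rwa [EReal.coe_add, EReal.coe_neg] at this
    | top =>
      rw [EReal.neg_top, EReal.bot_add, le_bot_iff, EReal.eq_bot_iff_forall_lt]
      intro y
      refine (key (ε - y + 1) (by rw [hψ]; exact le_top)).trans_lt ?_
      rw [EReal.coe_lt_coe_iff]
      linarith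

end LargeDeviations

/-- Two-sided bounds that hold up to every error `ε` determine the limit at the points of
continuity of the limiting bound. -/
lemma tendsto_of_forall_bounds {ψ : ℕ → ℝ → EReal} {u : ℕ → EReal} {f : ℝ → EReal} {U : Set ℝ}
    {b : ℝ} (hU : U ∈ 𝓝 b) (hψ : ∀ t ∈ U, Tendsto (fun n => ψ n t) atTop (𝓝 (f t)))
    (hf : ContinuousOn f U)
    (h : ∀ ε : ℝ, 0 < ε → ∀ᶠ n in atTop,
      -ψ n (b + ε) - (ε : EReal) ≤ u n ∧ u n ≤ -ψ n (b - ε) + (ε : EReal)) :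
    Tendsto u atTop (𝓝 (-f b)) := by
  have hfb : ContinuousAt f b := hf.continuousAt hU
  have hpos : ∀ᶠ ε : ℝ in 𝓝[>] 0, 0 < ε := self_mem_nhdsWithin
  have hshift : ∀ s : ℝ, Tendsto (fun ε : ℝ => b + s * ε) (𝓝[>] 0) (𝓝 b) := by
    intro s
    have : Tendsto (fun ε : ℝ => b + s * ε) (𝓝 0) (𝓝 (b + s * 0)) :=
      Continuous.tendsto (by fun_prop) 0
    rw [mul_zero, add_zero] at this
    exact this.mono_left nhdsWithin_le_nhds
  -- `s = 1` gives the lower bound and `s = -1` the upper one; adding a real number is continuous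
  -- on the extended reals, also at the infinite values
  have hcont : ∀ s : ℝ, Tendsto (fun ε : ℝ => -f (b + s * ε) + ((-s * ε : ℝ) : EReal)) (𝓝[>] 0)
      (𝓝 (-f b)) := by
    intro s
    have h2 : Tendsto (fun ε : ℝ => -f (b + s * ε)) (𝓝[>] 0) (𝓝 (-f b)) :=
      (continuous_neg.tendsto _).comp (hfb.tendsto.comp (hshift s))
    have h3 : Tendsto (fun ε : ℝ => ((-s * ε : ℝ) : EReal)) (𝓝[>] 0) (𝓝 ((0 : ℝ) : EReal)) := by
      refine (continuous_coe_real_ereal.tendsto _).comp ?_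
      have : Tendsto (fun ε : ℝ => -s * ε) (𝓝 0) (𝓝 (-s * 0)) :=
        Continuous.tendsto (by fun_prop) 0
      rw [mul_zero] at this
      exact this.mono_left nhdsWithin_le_nhds
    have h4 := (EReal.continuousAt_add (p := (-f b, ((0 : ℝ) : EReal)))
      (Or.inr (EReal.coe_ne_bot 0)) (Or.inr (EReal.coe_ne_top 0))).tendsto.comp
      (h2.prodMk_nhds h3)
    simpa [Function.comp_def] using h4
  have hlim : ∀ s : ℝ, ∀ᶠ ε : ℝ in 𝓝[>] 0,
      Tendsto (fun n => -ψ n (b + s * ε) + ((-s * ε : ℝ) : EReal)) atTop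
        (𝓝 (-f (b + s * ε) + ((-s * ε : ℝ) : EReal))) := by
    intro s
    filter_upwards [(hshift s).eventually hU] with ε hε
    exact (EReal.continuousAt_add (p := (-f (b + s * ε), ((-s * ε : ℝ) : EReal)))
      (Or.inr (EReal.coe_ne_bot _)) (Or.inr (EReal.coe_ne_top _))).tendsto.comp
      (((continuous_neg.tendsto _).comp (hψ _ hε)).prodMk_nhds tendsto_const_nhds)
  rw [tendsto_order]
  constructor
  · intro c hc
    obtain ⟨ε, hε0, hε1, hε2⟩ :=
      (hpos.and (((hcont 1).eventually_const_lt hc).and (hlim 1))).exists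
    filter_upwards [h ε hε0, hε2.eventually_const_lt hε1] with n h1 h2
    refine h2.trans_le (le_trans (le_of_eq ?_) h1.1)
    rw [one_mul, neg_one_mul, EReal.coe_neg, sub_eq_add_neg]
  · intro c hc
    obtain ⟨ε, hε0, hε1, hε2⟩ :=
      (hpos.and (((hcont (-1)).eventually_lt_const hc).and (hlim (-1)))).exists
    filter_upwards [h ε hε0, hε2.eventually_lt_const hε1] with n h1 h2
    refine (h1.2.trans (le_of_eq ?_)).trans_lt h2
    rw [neg_neg, one_mul, neg_one_mul, sub_eq_add_neg]

theorem mainTheorem4 {V : Type*} [Fintype V] (H : SimpleGraph V) [Fintype H.edgeSet]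
    (κ : ℕ) (hκ : H.edgeFinset.card = κ) (hκ0 : 1 ≤ κ) (b : ℝ) (hb : 1 < b) :
    (∀ ε : ℝ, 0 < ε → ∃ K : ℝ, ∀ᶠ n : ℕ in atTop, ∀ m : ℕ, m ≤ n.choose 2 →
      K ≤ edgeDensity n m * Real.log n ^ (1 / (2 * (κ : ℝ))) →
        -psiHat H n m (b + ε) - (ε : EReal) ≤ logUpperTail H n m b ∧
        logUpperTail H n m b ≤ -psiHat H n m (b - ε) + (ε : EReal)) ∧
    (∀ m : ℕ → ℕ, (∀ n, m n ≤ n.choose 2) →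
      Tendsto (fun n : ℕ => edgeDensity n (m n) * Real.log n ^ (1 / (2 * (κ : ℝ)))) atTop atTop →
      ∀ (f : ℝ → EReal) (U : Set ℝ), U ∈ 𝓝 b →
        (∀ t ∈ U, Tendsto (fun n => psiHat H n (m n) t) atTop (𝓝 (f t))) →
        ContinuousOn f U →
          Tendsto (fun n => logUpperTail H n (m n) b) atTop (𝓝 (-f b))) := by
  classical
  subst hκ
  refine ⟨fun ε hε => exists_forall_logUpperTail_bounds H hκ0 hb hε,
    fun m hm hp f U hU hψ hf => ?_⟩
  refine tendsto_of_forall_bounds (ψ := fun n t => psiHat H n (m n) t) hU hψ hf fun ε hε => ?_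
  obtain ⟨K, hK⟩ := exists_forall_logUpperTail_bounds H hκ0 hb hε
  filter_upwards [hK, hp.eventually_ge_atTop K] with n h1 h2
  exact h1 (m n) (hm n) h2
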